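/- Fix a field $\mathbb F$ and $n\in\mathbb N$. A zigzag module $\mathbb V$ of length $n$ is a sequence $V_1\leftrightarrow V_2\leftrightarrow\cdots\leftrightarrow V_n$ of finite-dimensional $\mathbb F$-vector spaces and linear maps, where each $\leftrightarrow$ is a single linear map pointing either forward or backward; the sequence $\tau\in\{\rightarrow,\leftarrow\}^{n-1}$ of directions is its type, and a module of type $\tau$ is called a $\tau$-module. Isomorphisms and direct sums (of modules of the same type) are componentwise. The interval module $\mathbb I_\tau([b,d])$, $1\le b\le d\le n$, has $\mathbb F$ at the indices in $[b,d]$, $0$ elsewhere, identities between adjacent copies of $\mathbb F$ and zero maps otherwise. Every $\tau$-module is isomorphic to a finite direct sum of interval modules, unique up to order; $\mathrm{Dgm}(\mathbb V)$ is the multiset of the endpoint pairs $(b,d)$ of its summands. Bottleneck distance. A matching $M$ between multisets $S,T$ of points of $\mathbb R^2$ is a bijection between a sub-multiset of $S$ and a sub-multiset of $T$ (points counted with multiplicity). Its cost $c_1(M)$ is the maximum of the numbers $\|s-t\|_1$ for matched pairs $(s,t)$ and $|r_y-r_x|$ for unmatched points $r=(r_x,r_y)$ of $S\sqcup T$ (with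 $\max\emptyset=0$), and $d_b^1(S,T)=\inf_M c_1(M)$. Reflection distance. For $1<k<n$, $\mathcal L_k(\mathbb V)$ (resp. $\mathcal C_k(\mathbb V)$) is obtained from $\mathbb V$ by replacing $V_{k-1}\leftrightarrow V_k\leftrightarrow V_{k+1}$ by $V_{k-1}\leftarrow L\rightarrow V_{k+1}$ (resp. $V_{k-1}\rightarrow C\leftarrow V_{k+1}$), where $L$ (resp. $C$) is the limit (resp. colimit) of that diagram with its canonical maps. For $k=1$ or $k=n$ the same is done after adding a zero space next to $V_1$ or $V_n$ at the missing side, joined to it by a zero map whose direction may be chosen freely; the added zero space is then discarded. These operations are the reflections $\mathcal R_k$. Let $\mathcal S(\mathbb V)$ be the direct sum of the $\mathbb I_\tau([b,d])$ over $(b,d)\in\mathrm{Dgm}(\mathbb V)$ with $b\ne d$. For a finite, possibly empty, sequence $\mathfrak R=(\mathcal R_{k_\ell},\dots,\mathcal R_{k_1})$ of reflections put $\mathfrak R(\mathbb V)=(\mathcal S\circ\mathcal R_{k_\ell}\circ\mathcal S\circ\cdots\circ\mathcal S\circ\mathcal R_{k_1}\circ\mathcal S)(\mathbb V)$ and $C_1(\mathfrak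 R)=\ell$. Write $\mathbb W\precsim\mathbb V$ if some module obtained from $\mathbb W$, up to isomorphism, by replacing finitely many (possibly no) structure maps that are isomorphisms by their inverses, pointing in the opposite direction, is a direct summand of $\mathbb V$ up to isomorphism. The $1$-reflection distance is $$d_{\mathcal R}^1(\mathbb V,\mathbb W)=\min\big\{\max\{C_1(\mathfrak R),C_1(\mathfrak R')\}\ :\ \mathfrak R(\mathbb V)\precsim\mathbb W,\ \mathfrak R'(\mathbb W)\precsim\mathbb V\big\},$$ the minimum over pairs of finite sequences of reflections (with value $\infty$ if there is no such pair). Proposition. Let $\tau\in\{\rightarrow,\leftarrow\}^{n-1}$. For all $\tau$-modules $\mathbb V,\mathbb W$ the number $d_{\mathcal R}^1(\mathbb V,\mathbb W)$ is finite and $$d_b^1(\mathrm{Dgm}(\mathbb V),\mathrm{Dgm}(\mathbb W))\ \le\ d_{\mathcal R}^1(\mathbb V,\mathbb W)\ \le\ n^2(n+1)\cdot d_b^1(\mathrm{Dgm}(\mathbb V),\mathrm{Dgm}(\mathbb W)).$$ So on modules of one fixed type the two distances are bi-Lipschitz equivalent. -/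

import Mathlib

open scoped ENNReal

universe u

noncomputable section

namespace Zigzag

/-! ### Types of zigzag modules -/

/-- The two symbols `→` and `←`. -/
inductive Dir
  | fwd
  | bwd

/-- Types of zigzag modules of length `n`: sequences of `n - 1` arrows. -/
abbrev ZType (n : ℕ) : Type := Fin (n - 1) → Dir

/-- Left endpoint of the `i`-th arrow. Position `j : Fin n` stands for the index `j + 1` of
`{1, …, n}`. -/
def lo {n : ℕ} (i : Fin (n - 1)) : Fin n := ⟨i.1, by omega⟩

/-- Right endpoint of the `i`-th arrow. -/
def hi {n : ℕ} (i : Fin (n - 1)) : Fin n := ⟨i.1 + 1, by omega⟩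

theorem lo_ne_hi {n : ℕ} (i : Fin (n - 1)) : lo i ≠ hi i := by
  intro h
  have := congrArg Fin.val h
  simp [lo, hi] at this

/-! ### Finite dimensional vector spaces and arrows between them -/

/-- A finite dimensional vector space over `F`. -/
structure FDSpace (F : Type u) [Field F] where
  carrier : Type u
  [addCommGroup : AddCommGroup carrier]
  [module : Module F carrier]
  [finite : FiniteDimensional F carrier]

attribute [instance] FDSpace.addCommGroup FDSpace.module FDSpace.finite

instance (F : Type u) [Field F] : CoeSort (FDSpace F) (Type u) := ⟨FDSpace.carrier⟩

/-- Equal spaces are linearly equivalent. -/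
def castEquiv {F : Type u} [Field F] {X Y : FDSpace F} (h : X = Y) : X ≃ₗ[F] Y :=
  h ▸ LinearEquiv.refl F X

/-- A structure map `X ⟷ Y`: a linear map `X → Y` or a linear map `X ← Y`. -/
inductive Arrow {F : Type u} [Field F] (X Y : FDSpace F)
  | fwd (p : X →ₗ[F] Y) : Arrow X Y
  | bwd (p : Y →ₗ[F] X) : Arrow X Y

namespace Arrow

variable {F : Type u} [Field F] {X Y X' Y' : FDSpace F}

/-- The direction of an arrow. -/
def dir : Arrow X Y → Dir
  | fwd _ => Dir.fwd
  | bwd _ => Dir.bwd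

/-- The elements `x` and `y` correspond to each other under the arrow. -/
def Rel : Arrow X Y → X → Y → Prop
  | fwd p, x, y => p x = y
  | bwd p, x, y => p y = x

/-- The square with horizontal sides the two arrows and vertical sides `f`, `g` makes sense
(the arrows point in the same direction) and commutes. -/
def Commutes (f : X →ₗ[F] X') (g : Y →ₗ[F] Y') : Arrow X Y → Arrow X' Y' → Prop
  | fwd p, fwd q => g ∘ₗ p = q ∘ₗ f
  | bwd p, bwd q => f ∘ₗ p = q ∘ₗ g
  | _, _ => False

/-- The arrow obtained by identifying its endpoints with other spaces. -/
def transport (e : X ≃ₗ[F] X') (f : Y ≃ₗ[F] Y') : Arrow X Y → Arrow X' Y'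
  | fwd p => fwd (f.toLinearMap ∘ₗ p ∘ₗ e.symm.toLinearMap)
  | bwd p => bwd (e.toLinearMap ∘ₗ p ∘ₗ f.symm.toLinearMap)

/-- The linear map of the arrow is an isomorphism. -/
def IsIso : Arrow X Y → Prop
  | fwd p => Function.Bijective p
  | bwd p => Function.Bijective p

/-- Replace an isomorphism by its inverse, pointing in the opposite direction. -/
def reverse : (a : Arrow X Y) → a.IsIso → Arrow X Y
  | fwd p, h => bwd (LinearEquiv.ofBijective p h).symm.toLinearMap
  | bwd p, h => fwd (LinearEquiv.ofBijective p h).symm.toLinearMap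

/-- The linear map of a forward arrow. -/
def toFwd : (a : Arrow X Y) → a.dir = Dir.fwd → X →ₗ[F] Y
  | fwd p, _ => p

/-- The linear map of a backward arrow. -/
def toBwd : (a : Arrow X Y) → a.dir = Dir.bwd → Y →ₗ[F] X
  | bwd p, _ => p

end Arrow

/-! ### Zigzag modules -/

/-- A zigzag module `V₁ ⟷ V₂ ⟷ ⋯ ⟷ Vₙ` of length `n` over `F`. -/
structure ZModule (F : Type u) [Field F] (n : ℕ) where
  space : Fin n → FDSpace F
  arrow : ∀ i : Fin (n - 1), Arrow (space (lo i)) (space (hi i))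

namespace ZModule

variable {F : Type u} [Field F] {n : ℕ}

/-- The type of a zigzag module. -/
def type (V : ZModule F n) : ZType n := fun i => (V.arrow i).dir

/-- Isomorphism of zigzag modules (which forces their types to agree). -/
def Iso (V W : ZModule F n) : Prop :=
  ∃ φ : ∀ j, V.space j ≃ₗ[F] W.space j,
    ∀ i, Arrow.Commutes (φ (lo i)).toLinearMap (φ (hi i)).toLinearMap (V.arrow i) (W.arrow i)

/-- Direct sum of a finite family of zigzag modules of type `τ`. -/
def directSum {ι : Type} [Finite ι] (τ : ZType n) (M : ι → ZModule F n)
    (hM : ∀ a, (M a).type = τ) : ZModule F n where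
  space j := ⟨∀ a, (M a).space j⟩
  arrow i :=
    match h : τ i with
    | Dir.fwd => Arrow.fwd (LinearMap.pi fun a =>
        ((M a).arrow i).toFwd ((congrFun (hM a) i).trans h) ∘ₗ LinearMap.proj a)
    | Dir.bwd => Arrow.bwd (LinearMap.pi fun a =>
        ((M a).arrow i).toBwd ((congrFun (hM a) i).trans h) ∘ₗ LinearMap.proj a)

/-- Direct sum `V ⊕ W` of two zigzag modules of the same type. -/
def prod (V W : ZModule F n) (hVW : V.type = W.type) : ZModule F n where
  space j := ⟨V.space j × W.space j⟩
  arrow i :=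
    match h : V.type i with
    | Dir.fwd => Arrow.fwd (((V.arrow i).toFwd h).prodMap
        ((W.arrow i).toFwd ((congrFun hVW i).symm.trans h)))
    | Dir.bwd => Arrow.bwd (((V.arrow i).toBwd h).prodMap
        ((W.arrow i).toBwd ((congrFun hVW i).symm.trans h)))

/-- `W ⪯ V`: `W` is a summand of `V`. -/
def IsSummand (W V : ZModule F n) : Prop :=
  ∃ (U : ZModule F n) (h : W.type = U.type), V.Iso (W.prod U h)

/-! ### Interval modules and persistence diagrams -/

/-- The whole field `F` if `P` holds, and `0` otherwise. -/
def barSpace (F : Type u) [Field F] (P : Prop) : Submodule F F where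
  carrier := {x | P ∨ x = 0}
  zero_mem' := Or.inr rfl
  add_mem' := by
    rintro a b (h | rfl) (h' | rfl)
    · exact Or.inl h
    · exact Or.inl h
    · exact Or.inl h'
    · exact Or.inr (add_zero _)
  smul_mem' := by
    rintro c x (h | rfl)
    · exact Or.inl h
    · exact Or.inr (smul_zero _)

open Classical in
/-- The identity of `F` if both `P` and `Q` hold, and `0` otherwise. -/
def barMap (F : Type u) [Field F] (P Q : Prop) : barSpace F P →ₗ[F] barSpace F Q where
  toFun x := if h : P ∧ Q then ⟨x.1, Or.inl h.2⟩ else 0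
  map_add' x y := by
    by_cases h : P ∧ Q
    · simp only [dif_pos h]; rfl
    · simp only [dif_neg h, add_zero]
  map_smul' c x := by
    by_cases h : P ∧ Q
    · simp only [dif_pos h]; rfl
    · simp only [dif_neg h, smul_zero]

/-- The position `j` lies in the interval `[b, d]` of `{1, …, n}`. -/
def InBar (x : ℕ × ℕ) (j : Fin n) : Prop := x.1 ≤ j.1 + 1 ∧ j.1 + 1 ≤ x.2

/-- The interval module on `[b, d]` of type `τ`, where `x = (b, d)`. -/
def interval (F : Type u) [Field F] (τ : ZType n) (x : ℕ × ℕ) : ZModule F n where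
  space j := ⟨barSpace F (InBar x j)⟩
  arrow i :=
    match τ i with
    | Dir.fwd => Arrow.fwd (barMap F (InBar x (lo i)) (InBar x (hi i)))
    | Dir.bwd => Arrow.bwd (barMap F (InBar x (hi i)) (InBar x (lo i)))

theorem interval_type (τ : ZType n) (x : ℕ × ℕ) : (interval F τ x).type = τ := by
  funext i
  simp only [type, interval]
  cases τ i <;> rfl

/-- The direct sum `⨁_{(b, d) ∈ D} I_τ([b, d])`, with multiplicities. -/
def intervalSum (F : Type u) [Field F] (τ : ZType n) (D : Multiset (ℕ × ℕ)) : ZModule F n :=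
  directSum τ (fun x : D.ToType => interval F τ x.1) (fun _ => interval_type τ _)

/-- `D` is the multiset of endpoints of an interval decomposition of `V`. -/
def IsDecomposition (V : ZModule F n) (D : Multiset (ℕ × ℕ)) : Prop :=
  (∀ x ∈ D, 1 ≤ x.1 ∧ x.1 ≤ x.2 ∧ x.2 ≤ n) ∧ V.Iso (intervalSum F V.type D)

open Classical in
/-- The persistence diagram: the multiset of endpoints of the intervals in the interval
decomposition of `V` (which exists and is unique for every zigzag module, by the theorems of
Gabriel and Krull–Remak–Schmidt, so that the `else` branch is never used). -/
def dgm (V : ZModule F n) : Multiset (ℕ × ℕ) :=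
  if h : ∃ D, V.IsDecomposition D then h.choose else 0

/-- Removal of the simple summands `I([k, k])`. -/
def sanitize (V : ZModule F n) : ZModule F n :=
  intervalSum F V.type (V.dgm.filter fun x => x.1 ≠ x.2)

/-! ### Reversing isomorphisms -/

/-- Reverse the `k`-th arrow, which is an isomorphism. -/
def reverse (V : ZModule F n) (k : Fin (n - 1)) (h : (V.arrow k).IsIso) : ZModule F n where
  space := V.space
  arrow := Function.update V.arrow k ((V.arrow k).reverse h)

/-- `V ∼ W`: up to isomorphism, `W` is obtained from `V` by finitely many (possibly no)
reversals of arrows that are isomorphisms. -/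
inductive Sim : ZModule F n → ZModule F n → Prop
  | iso {V W : ZModule F n} : V.Iso W → Sim V W
  | reverse {V W : ZModule F n} (k : Fin (n - 1)) (h : (V.arrow k).IsIso) :
      Sim (V.reverse k h) W → Sim V W

/-- `W ≾ V`: `W` is equivalent to a summand of `V`. -/
def SubSim (W V : ZModule F n) : Prop := ∃ W', Sim W W' ∧ W'.IsSummand V

/-! ### Reflections -/

/-- The positions `k - 1`, `k`, `k + 1`, as far as they exist. -/
abbrev Nbr (k : Fin n) : Type := {j : Fin n // k.1 ≤ j.1 + 1 ∧ j.1 ≤ k.1 + 1}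

/-- The position `k` as one of its neighbours. -/
def Nbr.self (k : Fin n) : Nbr k := ⟨k, by omega, by omega⟩

/-- The limit of `V_{k-1} ⟷ V_k ⟷ V_{k+1}`: the compatible families of elements.
At an end of the module the missing space is replaced by `0`, and the missing arrow (read from
left to right) has direction `e`. A family is compatible with `0 → V₁`, or with `Vₙ ← 0`, if its
entry at that end vanishes; the arrows `0 ← V₁` and `Vₙ → 0` impose nothing. -/
def limSpace (V : ZModule F n) (k : Fin n) (e : Dir) :
    Submodule F (∀ j : Nbr k, V.space j.1) where
  carrier := {x |
    (∀ (i : Fin (n - 1)) (h₁ : k.1 ≤ (lo i).1 + 1 ∧ (lo i).1 ≤ k.1 + 1)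
        (h₂ : k.1 ≤ (hi i).1 + 1 ∧ (hi i).1 ≤ k.1 + 1),
      (V.arrow i).Rel (x ⟨lo i, h₁⟩) (x ⟨hi i, h₂⟩)) ∧
    (k.1 = 0 → e = Dir.fwd → x (Nbr.self k) = 0) ∧
    (k.1 + 1 = n → e = Dir.bwd → x (Nbr.self k) = 0)}
  zero_mem' := by
    refine ⟨fun i h₁ h₂ => ?_, fun _ _ => rfl, fun _ _ => rfl⟩
    cases V.arrow i <;> simp [Arrow.Rel]
  add_mem' := by
    rintro x y ⟨hx, hx₁, hx₂⟩ ⟨hy, hy₁, hy₂⟩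
    refine ⟨fun i h₁ h₂ => ?_, fun h h' => ?_, fun h h' => ?_⟩
    · have hx' := hx i h₁ h₂
      have hy' := hy i h₁ h₂
      revert hx' hy'
      cases V.arrow i <;>
      · intro hx' hy'
        simp only [Arrow.Rel] at hx' hy'
        simp only [Arrow.Rel, Pi.add_apply, map_add, hx', hy']
    · simp [hx₁ h h', hy₁ h h']
    · simp [hx₂ h h', hy₂ h h']
  smul_mem' := by
    rintro c x ⟨hx, hx₁, hx₂⟩
    refine ⟨fun i h₁ h₂ => ?_, fun h h' => ?_, fun h h' => ?_⟩
    · have hx' := hx i h₁ h₂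
      revert hx'
      cases V.arrow i <;>
      · intro hx'
        simp only [Arrow.Rel] at hx'
        simp only [Arrow.Rel, Pi.smul_apply, map_smul, hx']
    · simp [hx₁ h h']
    · simp [hx₂ h h']

/-- The relations defining the colimit of `V_{k-1} ⟷ V_k ⟷ V_{k+1}`: elements that correspond
to each other under an arrow are identified. At an end of the module the missing space is
replaced by `0`, and the missing arrow (read from left to right) has direction `e`. The arrows
`0 ← V₁` and `Vₙ → 0` identify the elements of the space at that end with `0`; the arrows
`0 → V₁` and `Vₙ ← 0` impose nothing. -/
def colimRel (V : ZModule F n) (k : Fin n) (e : Dir) :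
    Submodule F (∀ j : Nbr k, V.space j.1) :=
  Submodule.span F ({z |
    (∃ (i : Fin (n - 1)) (h₁ : k.1 ≤ (lo i).1 + 1 ∧ (lo i).1 ≤ k.1 + 1)
        (h₂ : k.1 ≤ (hi i).1 + 1 ∧ (hi i).1 ≤ k.1 + 1)
        (x : V.space (lo i)) (y : V.space (hi i)), (V.arrow i).Rel x y ∧
        z = Pi.single (M := fun j : Nbr k => V.space j.1) ⟨lo i, h₁⟩ x -
          Pi.single (M := fun j : Nbr k => V.space j.1) ⟨hi i, h₂⟩ y) ∨
    ((k.1 = 0 ∧ e = Dir.bwd ∨ k.1 + 1 = n ∧ e = Dir.fwd) ∧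
      ∃ v : V.space k, z = Pi.single (M := fun j : Nbr k => V.space j.1) (Nbr.self k) v)})

/-- The space of a zigzag module with its `k`-th space replaced by `L`. -/
abbrev replaceSpace (V : ZModule F n) (k : Fin n) (L : FDSpace F) : Fin n → FDSpace F :=
  Function.update V.space k L

/-- At position `k` the space is `L`. -/
def replaceSelf (V : ZModule F n) {k j : Fin n} (L : FDSpace F) (h : j = k) :
    V.replaceSpace k L j ≃ₗ[F] L :=
  castEquiv (by subst h; exact Function.update_self ..)

/-- At all other positions the space is unchanged. -/
def replaceNe (V : ZModule F n) {k j : Fin n} (L : FDSpace F) (h : j ≠ k) :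
    V.replaceSpace k L j ≃ₗ[F] V.space j :=
  castEquiv (Function.update_of_ne h ..)

/-- Extroversion `𝓛_k`: the `k`-th space is replaced by the limit `L` of the diagram around it,
with the projections `V_{k-1} ← L → V_{k+1}`. -/
def extrovert (V : ZModule F n) (k : Fin n) (e : Dir) : ZModule F n where
  space := V.replaceSpace k ⟨V.limSpace k e⟩
  arrow i :=
    if h : hi i = k then
      Arrow.bwd ((V.replaceNe _ (fun h' => lo_ne_hi i (h'.trans h.symm))).symm.toLinearMap ∘ₗ
        (LinearMap.proj (⟨lo i, by subst h; simp [lo, hi]; omega⟩ : Nbr k) ∘ₗ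
          (V.limSpace k e).subtype) ∘ₗ (V.replaceSelf _ h).toLinearMap)
    else if h' : lo i = k then
      Arrow.fwd ((V.replaceNe _ h).symm.toLinearMap ∘ₗ
        (LinearMap.proj (⟨hi i, by subst h'; simp [lo, hi]; omega⟩ : Nbr k) ∘ₗ
          (V.limSpace k e).subtype) ∘ₗ (V.replaceSelf _ h').toLinearMap)
    else (V.arrow i).transport (V.replaceNe _ h').symm (V.replaceNe _ h).symm

/-- Introversion `𝓒_k`: the `k`-th space is replaced by the colimit `C` of the diagram around
it, with the canonical maps `V_{k-1} → C ← V_{k+1}`. -/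
def introvert (V : ZModule F n) (k : Fin n) (e : Dir) : ZModule F n where
  space := V.replaceSpace k ⟨(∀ j : Nbr k, V.space j.1) ⧸ V.colimRel k e⟩
  arrow i :=
    if h : hi i = k then
      Arrow.fwd ((V.replaceSelf _ h).symm.toLinearMap ∘ₗ
        ((V.colimRel k e).mkQ ∘ₗ LinearMap.single F (fun j : Nbr k => V.space j.1)
          (⟨lo i, by subst h; simp [lo, hi]; omega⟩ : Nbr k)) ∘ₗ
        (V.replaceNe _ (fun h' => lo_ne_hi i (h'.trans h.symm))).toLinearMap)
    else if h' : lo i = k then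
      Arrow.bwd ((V.replaceSelf _ h').symm.toLinearMap ∘ₗ
        ((V.colimRel k e).mkQ ∘ₗ LinearMap.single F (fun j : Nbr k => V.space j.1)
          (⟨hi i, by subst h'; simp [lo, hi]; omega⟩ : Nbr k)) ∘ₗ
        (V.replaceNe _ h).toLinearMap)
    else (V.arrow i).transport (V.replaceNe _ h').symm (V.replaceNe _ h).symm

end ZModule

/-- A reflection functor on zigzag modules of length `n`: `𝓛_k` or `𝓒_k`. The direction `e` of
the additional zero arrow matters only if `k` is the first or the last index. -/
inductive Reflection (n : ℕ)
  | ext (k : Fin n) (e : Dir) : Reflection n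
  | int (k : Fin n) (e : Dir) : Reflection n

namespace ZModule

variable {F : Type u} [Field F] {n : ℕ}

/-- Apply a reflection functor. -/
def reflect (V : ZModule F n) : Reflection n → ZModule F n
  | Reflection.ext k e => V.extrovert k e
  | Reflection.int k e => V.introvert k e

/-- Apply a sequence of reflections, the last one in the list first, removing simple summands
at the beginning and after each step. -/
def reflectSeq (V : ZModule F n) : List (Reflection n) → ZModule F n
  | [] => V.sanitize
  | R :: l => ((V.reflectSeq l).reflect R).sanitize

/-- The `1`-reflection distance. The `1`-cost of a sequence is its length. -/
def reflectionDist (V W : ZModule F n) : ℝ≥0∞ :=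
  ⨅ (R : List (Reflection n)) (R' : List (Reflection n))
    (_ : (V.reflectSeq R).SubSim W) (_ : (W.reflectSeq R').SubSim V),
    max (R.length : ℝ≥0∞) (R'.length : ℝ≥0∞)

end ZModule

/-! ### The bottleneck distance -/

/-- The `ℓ¹`-cost of a matching between the points of two multisets in the plane (points are
counted with multiplicity): the largest of the `ℓ¹`-distances of matched points and of the
numbers `|y - x|` for unmatched points `(x, y)`. -/
def matchingCost {S T : Multiset (ℝ × ℝ)} (M : S.ToType ≃. T.ToType) : ℝ≥0∞ :=
  max (⨆ (s : S.ToType) (t : T.ToType) (_ : t ∈ M s),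
      ENNReal.ofReal (|s.1.1 - t.1.1| + |s.1.2 - t.1.2|))
    (max (⨆ (s : S.ToType) (_ : M s = none), ENNReal.ofReal |s.1.2 - s.1.1|)
      (⨆ (t : T.ToType) (_ : M.symm t = none), ENNReal.ofReal |t.1.2 - t.1.1|))

/-- The `ℓ¹`-bottleneck distance of two multisets of points in the plane. -/
def bottleneckDist (S T : Multiset (ℝ × ℝ)) : ℝ≥0∞ :=
  ⨅ M : S.ToType ≃. T.ToType, matchingCost M

/-- A diagram as a multiset of points in the plane. -/
def toPlane (D : Multiset (ℕ × ℕ)) : Multiset (ℝ × ℝ) :=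
  D.map fun x => ((x.1 : ℝ), (x.2 : ℝ))

end Zigzag

end

noncomputable section

namespace Zigzag

/-! Everything is reduced to combinatorics of bars. A structure map is treated through its graph
`Arrow.Rel`, so that both directions are handled alike, and `Coords` records a decomposition as
injective coordinate maps into `ι → F` in which an arrow relates `x` and `y` exactly when their
coordinates agree for every summand alive at the target. Such coordinates exist for every module
(`exists_coords`, which splits off one interval at a time), their bars are unique
(`Coords.map_bar_eq`, through ranks of linear relations), and they are carried along by direct sums,
reversals of isomorphisms and reflections.

Limits and colimits commute with the finite direct sum, so a reflection at `k` changes each bar only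
at the position `k`. A bar with at least two indices is thereby enlarged or shrunk by at most one
index at one end (`Reflection.exists_bar`). After `ℓ` reflections every surviving bar has moved by
at most `ℓ` in the ℓ¹-norm, and every lost bar had `d - b ≤ ℓ` (`Coords.reflectSeq`). If the result
is equivalent to a summand of `W`, this is a matching of cost at most `ℓ`, except that points of `W`
may be unmatched at no controlled cost. The second sequence gives the same with the roles exchanged,
and the Mendelsohn–Dulmage theorem (`exists_pequiv_of_pequiv`) merges the two matchings into one
that controls both sides. This is the lower bound.

For the upper bound, diagram points are integral, so every matching cost is an integer. If the
bottleneck distance is below `1`, the diagrams agree off the diagonal, the sanitized modules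
coincide and no reflection is needed. Otherwise a crude estimate suffices: any module is annihilated
by `3 * (n - 1)` reflections (`exists_reflectSeq_subSim`), a zero module is equivalent to a summand
of anything, and `3 * (n - 1) ≤ n ^ 2 * (n + 1)`. The same estimate shows finiteness. -/

/-- The position an arrow of direction `d` points to. -/
def tgt {n : ℕ} (d : Dir) (i : Fin (n - 1)) : Fin n :=
  match d with
  | Dir.fwd => hi i
  | Dir.bwd => lo i

/-- The position an arrow of direction `d` comes from. -/
def src {n : ℕ} (d : Dir) (i : Fin (n - 1)) : Fin n :=
  match d with
  | Dir.fwd => lo i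
  | Dir.bwd => hi i

/-! ### Structure maps as linear relations -/

namespace Arrow

variable {F : Type u} [Field F] {X Y X' Y' : FDSpace F}

theorem rel_iff_toFwd (a : Arrow X Y) (h : a.dir = Dir.fwd) (x : X) (y : Y) :
    a.Rel x y ↔ a.toFwd h x = y := by
  cases a with
  | fwd p => rfl
  | bwd p => cases h

theorem rel_iff_toBwd (a : Arrow X Y) (h : a.dir = Dir.bwd) (x : X) (y : Y) :
    a.Rel x y ↔ a.toBwd h y = x := by
  cases a with
  | fwd p => cases h
  | bwd p => rfl

theorem Commutes.dir_eq {f : X →ₗ[F] X'} {g : Y →ₗ[F] Y'} {a : Arrow X Y} {b : Arrow X' Y'}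
    (h : Commutes f g a b) : a.dir = b.dir := by
  cases a <;> cases b <;> first | rfl | exact h.elim

theorem Commutes.rel_iff {f : X ≃ₗ[F] X'} {g : Y ≃ₗ[F] Y'} {a : Arrow X Y} {b : Arrow X' Y'}
    (h : Commutes f.toLinearMap g.toLinearMap a b) (x : X) (y : Y) :
    a.Rel x y ↔ b.Rel (f x) (g y) := by
  cases a with
  | fwd p =>
    cases b with
    | fwd q =>
      have := LinearMap.congr_fun h x
      simp only [LinearMap.comp_apply, LinearEquiv.coe_coe] at this
      simp [Rel, ← this]
    | bwd q => exact h.elim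
  | bwd p =>
    cases b with
    | fwd q => exact h.elim
    | bwd q =>
      have := LinearMap.congr_fun h y
      simp only [LinearMap.comp_apply, LinearEquiv.coe_coe] at this
      simp [Rel, ← this]

/-- Both relations are graphs of functions with the same source side, so one inclusion of graphs
already gives the commuting square. -/
theorem commutes_of_rel {f : X →ₗ[F] X'} {g : Y →ₗ[F] Y'} {a : Arrow X Y} {b : Arrow X' Y'}
    (hd : a.dir = b.dir) (h : ∀ x y, a.Rel x y → b.Rel (f x) (g y)) : Commutes f g a b := by
  cases a with
  | fwd p =>
    cases b with
    | fwd q => exact LinearMap.ext fun x => (h x (p x) rfl).symm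
    | bwd q => cases hd
  | bwd p =>
    cases b with
    | fwd q => cases hd
    | bwd q => exact LinearMap.ext fun y => (h (p y) y rfl).symm

@[simp] theorem transport_dir (e : X ≃ₗ[F] X') (f : Y ≃ₗ[F] Y') (a : Arrow X Y) :
    (a.transport e f).dir = a.dir := by
  cases a <;> rfl

theorem transport_rel (e : X ≃ₗ[F] X') (f : Y ≃ₗ[F] Y') (a : Arrow X Y) (x : X') (y : Y') :
    (a.transport e f).Rel x y ↔ a.Rel (e.symm x) (f.symm y) := by
  cases a with
  | fwd p => simp [transport, Rel, LinearEquiv.eq_symm_apply]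
  | bwd p => simp [transport, Rel, LinearEquiv.eq_symm_apply]

/-- A bijection and its inverse have the same graph. For this reason notions that see an arrow only
through `Rel` survive reversals. -/
theorem reverse_rel (a : Arrow X Y) (h : a.IsIso) (x : X) (y : Y) :
    (a.reverse h).Rel x y ↔ a.Rel x y := by
  cases a with
  | fwd p =>
    simp only [reverse, Rel, LinearEquiv.coe_coe, LinearEquiv.symm_apply_eq]
    exact eq_comm
  | bwd p =>
    simp only [reverse, Rel, LinearEquiv.coe_coe, LinearEquiv.symm_apply_eq]
    exact eq_comm

theorem reverse_dir (a : Arrow X Y) (h : a.IsIso) : (a.reverse h).dir ≠ a.dir := by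
  cases a <;> simp [reverse, dir]

end Arrow

/-! ### Relations of direct sums and interval modules -/

namespace ZModule

variable {F : Type u} [Field F] {n : ℕ}

theorem directSum_type {ι : Type} [Finite ι] (τ : ZType n) (M : ι → ZModule F n)
    (hM : ∀ a, (M a).type = τ) : (directSum τ M hM).type = τ := by
  funext i
  simp only [type, directSum]
  split <;> simp_all [Arrow.dir]

theorem directSum_rel {ι : Type} [Finite ι] (τ : ZType n) (M : ι → ZModule F n)
    (hM : ∀ a, (M a).type = τ) (i : Fin (n - 1)) (x : (directSum τ M hM).space (lo i))
    (y : (directSum τ M hM).space (hi i)) :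
    ((directSum τ M hM).arrow i).Rel x y ↔
      ∀ a, ((M a).arrow i).Rel ((x : ∀ a, (M a).space (lo i)) a)
        ((y : ∀ a, (M a).space (hi i)) a) := by
  simp only [directSum]
  split
  · next h =>
    exact Iff.trans funext_iff (forall_congr' fun a =>
      (Arrow.rel_iff_toFwd _ ((congrFun (hM a) i).trans h) _ _).symm)
  · next h =>
    exact Iff.trans funext_iff (forall_congr' fun a =>
      (Arrow.rel_iff_toBwd _ ((congrFun (hM a) i).trans h) _ _).symm)

theorem prod_type (V W : ZModule F n) (hVW : V.type = W.type) :
    (V.prod W hVW).type = V.type := by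
  funext i
  conv_lhs => simp only [type, prod]
  split
  · next h => exact h.symm
  · next h => exact h.symm

theorem prod_rel (V W : ZModule F n) (hVW : V.type = W.type) (i : Fin (n - 1))
    (x : (V.prod W hVW).space (lo i)) (y : (V.prod W hVW).space (hi i)) :
    ((V.prod W hVW).arrow i).Rel x y ↔
      (V.arrow i).Rel (x : V.space (lo i) × W.space (lo i)).1
          (y : V.space (hi i) × W.space (hi i)).1 ∧
        (W.arrow i).Rel (x : V.space (lo i) × W.space (lo i)).2
          (y : V.space (hi i) × W.space (hi i)).2 := by
  simp only [prod]
  split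
  · next h =>
    rw [Arrow.rel_iff_toFwd _ h, Arrow.rel_iff_toFwd _ ((congrFun hVW i).symm.trans h)]
    exact Prod.ext_iff
  · next h =>
    rw [Arrow.rel_iff_toBwd _ h, Arrow.rel_iff_toBwd _ ((congrFun hVW i).symm.trans h)]
    exact Prod.ext_iff

-- If the target lies outside the bar, the target space is zero and there is no condition. If only
-- the source lies outside, its coordinate is zero and the equation forces the target coordinate to
-- vanish, as the zero map does. So a test at the target alone covers all cases; this is the model
-- for the field `rel` of `Coords`.
open Classical in
theorem interval_rel (τ : ZType n) (z : ℕ × ℕ) (i : Fin (n - 1))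
    (x : (interval F τ z).space (lo i)) (y : (interval F τ z).space (hi i)) :
    ((interval F τ z).arrow i).Rel x y ↔
      (InBar z (tgt (τ i) i) → (x : barSpace F (InBar z (lo i))).1 =
        (y : barSpace F (InBar z (hi i))).1) := by
  have key : ∀ (P Q : Prop) (x : barSpace F P) (y : barSpace F Q),
      barMap F P Q x = y ↔ (Q → x.1 = y.1) := by
    rintro P Q ⟨x, hx⟩ ⟨y, hy⟩
    by_cases hQ : Q
    · by_cases hP : P
      · have : barMap F P Q ⟨x, hx⟩ = ⟨x, Or.inl hQ⟩ := dif_pos ⟨hP, hQ⟩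
        rw [this, Subtype.ext_iff]
        simp [hQ]
      · have : x = 0 := hx.resolve_left hP
        subst this
        simp [barMap, hP, hQ, Subtype.ext_iff]
    · have : y = 0 := hy.resolve_left hQ
      subst this
      simp [barMap, hQ, Subtype.ext_iff]
  simp only [interval]
  cases h : τ i
  · exact key _ _ x y
  · exact (key _ _ y x).trans ⟨fun h hb => (h hb).symm, fun h hb => (h hb).symm⟩

/-! ### Coordinates adapted to a decomposition -/

/-- Coordinates on `V` indexed by `ι` that exhibit `V` as a direct sum of modules `M a`, `a : ι`,
with `M a` equal to the field on the set `P a` of positions, `0` elsewhere, and identities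
as structure maps between adjacent positions of `P a`. -/
structure Coords (V : ZModule F n) {ι : Type} (P : ι → Fin n → Prop) where
  φ : ∀ j, V.space j →ₗ[F] (ι → F)
  inj : ∀ j, Function.Injective (φ j)
  surj : ∀ j c, (∀ a, ¬P a j → c a = 0) → ∃ v, φ j v = c
  supp : ∀ j v a, ¬P a j → φ j v a = 0
  rel : ∀ i x y, (V.arrow i).Rel x y ↔
    ∀ a, P a (tgt (V.type i) i) → φ (lo i) x a = φ (hi i) y a

namespace Coords

variable {V W : ZModule F n} {ι κ : Type} {P : ι → Fin n → Prop} {Q : κ → Fin n → Prop}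

/-- Coordinates pull back along isomorphisms. -/
def ofIso (C : Coords W P) (φ : ∀ j, V.space j ≃ₗ[F] W.space j)
    (hφ : ∀ i, Arrow.Commutes (φ (lo i)).toLinearMap (φ (hi i)).toLinearMap
      (V.arrow i) (W.arrow i)) : Coords V P where
  φ j := C.φ j ∘ₗ (φ j).toLinearMap
  inj j := (C.inj j).comp (φ j).injective
  surj j c hc := by
    obtain ⟨w, hw⟩ := C.surj j c hc
    exact ⟨(φ j).symm w, by simp [hw]⟩
  supp j v a ha := C.supp j _ a ha
  rel i x y := by
    rw [(hφ i).rel_iff, C.rel, show V.type i = W.type i from (hφ i).dir_eq]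
    rfl

theorem nonempty_of_iso (C : Coords W P) (h : V.Iso W) : Nonempty (Coords V P) := by
  obtain ⟨φ, hφ⟩ := h
  exact ⟨C.ofIso φ hφ⟩

/-- The space at position `j` as a submodule of the coordinate space. -/
def suppSpace (F : Type u) [Field F] (P : ι → Fin n → Prop) (j : Fin n) :
    Submodule F (ι → F) where
  carrier := {c | ∀ a, ¬P a j → c a = 0}
  zero_mem' _ _ := rfl
  add_mem' h h' a ha := by simp [h a ha, h' a ha]
  smul_mem' r _ h a ha := by simp [h a ha]

/-- The identification of the space at position `j` with a submodule of the coordinate space. -/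
def equiv (C : Coords V P) (j : Fin n) : V.space j ≃ₗ[F] suppSpace F P j :=
  LinearEquiv.ofBijective ((C.φ j).codRestrict (suppSpace F P j) fun v => C.supp j v)
    ⟨fun x y h => C.inj j (congrArg Subtype.val h), fun c => by
      obtain ⟨v, hv⟩ := C.surj j c.1 c.2
      exact ⟨v, Subtype.ext hv⟩⟩

@[simp] theorem coe_equiv (C : Coords V P) (j : Fin n) (v : V.space j) :
    (C.equiv j v : ι → F) = C.φ j v := rfl

@[simp] theorem φ_equiv_symm (C : Coords V P) (j : Fin n) (c : suppSpace F P j) :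
    C.φ j ((C.equiv j).symm c) = c := by
  rw [← coe_equiv, LinearEquiv.apply_symm_apply]

/-- In coordinates the spaces depend only on `P` and the relations only on `P` and the type, so
equal data give isomorphic modules. -/
theorem iso (C : Coords V P) (D : Coords W P) (h : V.type = W.type) : V.Iso W := by
  refine ⟨fun j => (C.equiv j).trans (D.equiv j).symm, fun i => ?_⟩
  refine Arrow.commutes_of_rel (congrFun h i) fun x y hxy => ?_
  rw [D.rel]
  rw [C.rel] at hxy
  intro a ha
  rw [← h] at ha
  simpa using hxy a ha

open Classical in
/-- Replace the entries of the summands that do not contain `j` by `0`. -/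
def mask (F : Type u) [Field F] (P : ι → Fin n → Prop) (j : Fin n) :
    (ι → F) →ₗ[F] suppSpace F P j where
  toFun c := ⟨fun a => if P a j then c a else 0, fun a ha => if_neg ha⟩
  map_add' c d := Subtype.ext (funext fun a => by
    by_cases h : P a j <;> simp [h])
  map_smul' r c := Subtype.ext (funext fun a => by
    by_cases h : P a j <;> simp [h])

/-- The element at position `j` whose coordinates are those of `c` for the summands that
contain `j`. -/
def vec (C : Coords V P) (j : Fin n) : (ι → F) →ₗ[F] V.space j :=
  (C.equiv j).symm.toLinearMap ∘ₗ mask F P j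

open Classical in
theorem φ_vec (C : Coords V P) (j : Fin n) (c : ι → F) (a : ι) :
    C.φ j (C.vec j c) a = if P a j then c a else 0 := by
  simp only [vec, LinearMap.comp_apply, LinearEquiv.coe_coe, φ_equiv_symm]
  rfl

theorem vec_φ (C : Coords V P) (j : Fin n) (v : V.space j) : C.vec j (C.φ j v) = v := by
  refine C.inj j (funext fun a => ?_)
  rw [φ_vec]
  split
  · rfl
  · next h => exact (C.supp j v a h).symm

/-- Coordinates indexed by an equivalent type. -/
def reindex (C : Coords V P) (e : κ ≃ ι) (h : ∀ a j, Q a j ↔ P (e a) j) : Coords V Q where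
  φ j := (LinearEquiv.funCongrLeft F F e).toLinearMap ∘ₗ C.φ j
  inj j := (LinearEquiv.funCongrLeft F F e).injective.comp (C.inj j)
  surj j c hc := by
    obtain ⟨v, hv⟩ := C.surj j (fun a => c (e.symm a)) fun a ha => hc _ (by rw [h]; simpa using ha)
    exact ⟨v, by ext a; simp [LinearEquiv.funCongrLeft, hv, LinearMap.funLeft]⟩
  supp j v a ha := C.supp j v _ (by rwa [h] at ha)
  rel i x y := by
    rw [C.rel, ← e.forall_congr_right]
    refine forall_congr' fun a => ?_
    rw [h]
    rfl

/-- Summands that are zero may be dropped. -/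
def restrict (C : Coords V P) (A : ι → Prop) (hA : ∀ a, ¬A a → ∀ j, ¬P a j) :
    Coords V (fun (a : {a // A a}) j => P a.1 j) where
  φ j := LinearMap.funLeft F F Subtype.val ∘ₗ C.φ j
  inj j x y h := by
    refine C.inj j (funext fun a => ?_)
    by_cases ha : A a
    · exact congrFun h ⟨a, ha⟩
    · rw [C.supp j x a (hA a ha j), C.supp j y a (hA a ha j)]
  surj j c hc := by
    classical
    obtain ⟨v, hv⟩ := C.surj j (fun a => if h : A a then c ⟨a, h⟩ else 0) fun a ha => by
      by_cases h : A a
      · simp [h, hc ⟨a, h⟩ ha]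
      · simp [h]
    exact ⟨v, by ext a; simp [hv, LinearMap.funLeft, a.2]⟩
  supp j v a ha := C.supp j v _ ha
  rel i x y := by
    rw [C.rel]
    refine ⟨fun h a ha => h a.1 ha, fun h a ha => ?_⟩
    by_cases hA' : A a
    · exact h ⟨a, hA'⟩ ha
    · exact (hA a hA' _ ha).elim

/-- Coordinates of a direct sum of two modules. -/
def prod (C : Coords V P) (D : Coords W Q) (h : V.type = W.type) :
    Coords (V.prod W h) (Sum.elim P Q) where
  φ j := LinearMap.pi (Sum.rec
    (fun a => LinearMap.proj a ∘ₗ C.φ j ∘ₗ LinearMap.fst F (V.space j) (W.space j))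
    (fun a => LinearMap.proj a ∘ₗ D.φ j ∘ₗ LinearMap.snd F (V.space j) (W.space j)))
  inj j x y h := by
    refine Prod.ext (C.inj j (funext fun a => ?_)) (D.inj j (funext fun a => ?_))
    · exact congrFun h (Sum.inl a)
    · exact congrFun h (Sum.inr a)
  surj j c hc := by
    obtain ⟨v, hv⟩ := C.surj j (fun a => c (Sum.inl a)) fun a ha => hc _ ha
    obtain ⟨w, hw⟩ := D.surj j (fun a => c (Sum.inr a)) fun a ha => hc _ ha
    refine ⟨(v, w), funext fun a => ?_⟩
    cases a with
    | inl a => exact congrFun hv a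
    | inr a => exact congrFun hw a
  supp j v a ha := by
    cases a with
    | inl a => exact C.supp j v.1 a ha
    | inr a => exact D.supp j v.2 a ha
  rel i x y := by
    rw [prod_rel, C.rel, D.rel, prod_type, ← h, Sum.forall]
    rfl

/-- The coordinates of a sum of intervals. -/
def ofIntervalSum (τ : ZType n) (D : Multiset (ℕ × ℕ)) :
    Coords (intervalSum F τ D) (fun a : D.ToType => InBar a.1) where
  φ j := LinearMap.pi fun a => (barSpace F (InBar a.1 j)).subtype ∘ₗ
    LinearMap.proj (φ := fun a : D.ToType => barSpace F (InBar a.1 j)) a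
  inj j x y h := funext fun a => Subtype.ext (congrFun h a)
  surj j c hc := ⟨fun a => ⟨c a, or_iff_not_imp_left.mpr (hc a)⟩, rfl⟩
  supp j v a ha := (v a).2.resolve_left ha
  rel i x y := by
    rw [show (intervalSum F τ D).type = τ from directSum_type ..]
    refine (directSum_rel ..).trans (forall_congr' fun a => ?_)
    rw [interval_rel]
    rfl

/-- If a bar contained only one end of the arrow, its basis vector there would either be killed by
the map or lie outside its image, depending on the direction. Neither is possible for an
isomorphism. -/
theorem reverse_mem_iff (C : Coords V P) {k : Fin (n - 1)} (h : (V.arrow k).IsIso) (a : ι) :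
    P a (lo k) ↔ P a (hi k) := by
  classical
  -- The graph of an isomorphism is total, onto, single-valued and one-to-one; in this form the
  -- direction plays no role.
  have key : ∀ {X Y : FDSpace F} (b : Arrow X Y), b.IsIso →
      (∀ x, ∃ y, b.Rel x y) ∧ (∀ y, ∃ x, b.Rel x y) ∧
        (∀ x y y', b.Rel x y → b.Rel x y' → y = y') ∧
        (∀ x x' y, b.Rel x y → b.Rel x' y → x = x') := by
    intro X Y b hb
    cases b with
    | fwd p =>
      exact ⟨fun x => ⟨p x, rfl⟩, fun y => hb.2 y, fun x y y' h h' => h.symm.trans h',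
        fun x x' y h h' => hb.1 (h.trans h'.symm)⟩
    | bwd p =>
      exact ⟨fun x => hb.2 x, fun y => ⟨p y, rfl⟩,
        fun x y y' h h' => hb.1 (h.trans h'.symm), fun x x' y h h' => h.symm.trans h'⟩
  obtain ⟨h₁, h₂, h₃, h₄⟩ := key _ h
  have hv : ∀ j, P a j → C.vec j (Pi.single a 1) ≠ 0 := by
    intro j hj h0
    have := C.φ_vec j (Pi.single a 1) a
    rw [h0] at this
    simp [hj] at this
  have h00 : (V.arrow k).Rel 0 0 := (C.rel k 0 0).2 (by simp)
  by_contra hne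
  rcases not_iff.mp hne |>.symm with hne
  by_cases hl : P a (lo k)
  · have hh : ¬P a (hi k) := fun hh => (hne.mp hh) hl
    rcases hd : V.type k with _ | _
    · refine hv _ hl (h₄ _ _ 0 ((C.rel k _ _).2 fun b hb => ?_) h00)
      rw [hd] at hb
      have hba : b ≠ a := by rintro rfl; exact hh hb
      simp [φ_vec, hba]
    · obtain ⟨y, hy⟩ := h₁ (C.vec (lo k) (Pi.single a 1))
      have := (C.rel k _ _).1 hy a (by rw [hd]; exact hl)
      simp [φ_vec, hl, C.supp _ _ _ hh] at this
  · have hh : P a (hi k) := hne.mpr hl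
    rcases hd : V.type k with _ | _
    · obtain ⟨x, hx⟩ := h₂ (C.vec (hi k) (Pi.single a 1))
      have := (C.rel k _ _).1 hx a (by rw [hd]; exact hh)
      simp [φ_vec, hh, C.supp _ _ _ hl] at this
    · refine hv _ hh (h₃ 0 _ _ ((C.rel k _ _).2 fun b hb => ?_) h00)
      rw [hd] at hb
      have hba : b ≠ a := by rintro rfl; exact hl hb
      simp [φ_vec, hba]

/-- Reversing an isomorphism does not change the coordinates. -/
def reverse (C : Coords V P) {k : Fin (n - 1)} (h : (V.arrow k).IsIso) :
    Coords (V.reverse k h) P where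
  φ := C.φ
  inj := C.inj
  surj := C.surj
  supp := C.supp
  rel i x y := by
    have key : ∀ (b : Arrow (V.space (lo i)) (V.space (hi i))) (x : V.space (lo i))
        (y : V.space (hi i)), (b = V.arrow i ∨ ∃ h : (V.arrow i).IsIso, b = (V.arrow i).reverse h) →
        (b.Rel x y ↔ ∀ a, P a (tgt b.dir i) → C.φ (lo i) x a = C.φ (hi i) y a) := by
      rintro b x y (rfl | ⟨h, rfl⟩)
      · exact C.rel i x y
      · rw [Arrow.reverse_rel, C.rel]
        refine forall_congr' fun a => ?_
        have hm := C.reverse_mem_iff h a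
        -- Each bar contains both ends of the arrow or neither, so the test at the target is the
        -- same for either direction.
        have : ∀ d : Dir, P a (tgt d i) ↔ P a (lo i) := by
          rintro (_ | _)
          · exact hm.symm
          · exact Iff.rfl
        rw [this, this]
    refine key _ x y ?_
    by_cases hik : i = k
    · subst hik
      exact Or.inr ⟨h, Function.update_self ..⟩
    · exact Or.inl (Function.update_of_ne hik ..)

theorem nonempty_of_sim (C : Coords V P) (h : Sim V W) : Nonempty (Coords W P) := by
  induction h with
  | iso h =>
    obtain ⟨φ, hφ⟩ := h
    refine ⟨C.ofIso (fun j => (φ j).symm) fun i => ?_⟩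
    refine Arrow.commutes_of_rel (hφ i).dir_eq.symm fun x y hxy => ?_
    rw [(hφ i).rel_iff]
    simpa using hxy
  | reverse k h _ ih => exact ih (C.reverse h)

end Coords

end ZModule

theorem Arrow.rel_add {F : Type u} [Field F] {X Y : FDSpace F} (a : Arrow X Y) {x x' : X}
    {y y' : Y} (h : a.Rel x y) (h' : a.Rel x' y') : a.Rel (x + x') (y + y') := by
  cases a <;> simp_all [Arrow.Rel]

theorem Arrow.rel_smul {F : Type u} [Field F] {X Y : FDSpace F} (a : Arrow X Y) (r : F) {x : X}
    {y : Y} (h : a.Rel x y) : a.Rel (r • x) (r • y) := by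
  cases a <;> simp_all [Arrow.Rel]

theorem Arrow.rel_zero {F : Type u} [Field F] {X Y : FDSpace F} (a : Arrow X Y) :
    a.Rel 0 0 := by
  cases a <;> simp [Arrow.Rel]

/-! ### Uniqueness of the interval decomposition -/

namespace ZModule

variable {F : Type u} [Field F] {n : ℕ}

/-- The family `v` is compatible with the arrows between the positions `b` and `m`. -/
def Compat (V : ZModule F n) (b m : ℕ) (v : ∀ j, V.space j) : Prop :=
  ∀ i : Fin (n - 1), b ≤ i.1 → i.1 < m → (V.arrow i).Rel (v (lo i)) (v (hi i))

/-- The elements at position `b` that extend to a compatible family up to position `m` whose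
last entry lies in `S`. -/
def pullSpace (V : ZModule F n) (b m : Fin n) (S : Submodule F (V.space m)) :
    Submodule F (V.space b) where
  carrier := {x | ∃ v : ∀ j, V.space j, v b = x ∧ V.Compat b m v ∧ v m ∈ S}
  zero_mem' := ⟨0, rfl, fun _ _ _ => Arrow.rel_zero _, S.zero_mem⟩
  add_mem' := by
    rintro _ _ ⟨v, rfl, hv, hS⟩ ⟨w, rfl, hw, hS'⟩
    exact ⟨v + w, rfl, fun i h h' => Arrow.rel_add _ (hv i h h') (hw i h h'), S.add_mem hS hS'⟩
  smul_mem' := by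
    rintro r _ ⟨v, rfl, hv, hS⟩
    exact ⟨r • v, rfl, fun i h h' => Arrow.rel_smul _ r (hv i h h'), S.smul_mem r hS⟩

/-- The rank of the linear relation between the positions `b` and `d`. -/
def relRank (V : ZModule F n) (b d : Fin n) : ℕ :=
  Module.finrank F (V.pullSpace b d ⊤ ⧸
    (V.pullSpace b d ⊥).comap (V.pullSpace b d ⊤).subtype)

namespace Coords

variable {V : ZModule F n} {ι : Type} {P : ι → Fin n → Prop}

theorem eq_of_compat (C : Coords V P) {b d : Fin n} {v : ∀ j, V.space j}
    (hv : V.Compat b d v) {a : ι} (ha : ∀ j, b ≤ j → j ≤ d → P a j) (j : Fin n) (hbj : b ≤ j)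
    (hjd : j ≤ d) : C.φ j (v j) a = C.φ b (v b) a := by
  obtain ⟨j, hj⟩ := j
  induction j with
  | zero =>
    have : b = ⟨0, hj⟩ := le_antisymm hbj (Nat.zero_le _)
    rw [this]
  | succ j ih =>
    rcases hbj.eq_or_lt with h | h
    · rw [← h]
    · have hb' : b.1 ≤ j := Nat.lt_succ_iff.mp h
      have hd' : j + 1 ≤ d.1 := hjd
      rw [← ih (by omega) hb' (by simp [Fin.le_def]; omega)]
      have := (C.rel ⟨j, by omega⟩ _ _).1 (hv ⟨j, by omega⟩ hb' (by simp; omega)) a (by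
        rcases V.type ⟨j, by omega⟩ with _ | _
        · exact ha _ (by simp [tgt, hi, Fin.le_def]; omega) hjd
        · exact ha _ (by simpa [tgt, lo, Fin.le_def]) (by simp [tgt, lo, Fin.le_def]; omega))
      exact this.symm

/-- A compatible family has a constant coordinate along every bar that covers `[b, d]`. A bar that
contains `b` but not `d` does not obstruct ending in `0` at `d`. Hence the quotient has as
coordinates exactly those of the bars that contain both ends. -/
theorem relRank_eq (C : Coords V P) [Finite ι]
    (hP : ∀ a (i j k : Fin n), i ≤ j → j ≤ k → P a i → P a k → P a j) {b d : Fin n}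
    (hbd : b ≤ d) : V.relRank b d = Nat.card {a // P a b ∧ P a d} := by
  classical
  have := Fintype.ofFinite ι
  let g : V.pullSpace b d ⊤ →ₗ[F] ({a // P a b ∧ P a d} → F) :=
    LinearMap.funLeft F F Subtype.val ∘ₗ C.φ b ∘ₗ (V.pullSpace b d ⊤).subtype
  have hconst : ∀ {v : ∀ j, V.space j}, V.Compat b d v → ∀ a, P a b → P a d →
      C.φ d (v d) a = C.φ b (v b) a := fun hv a h₁ h₂ =>
    C.eq_of_compat hv (fun j h h' => hP a _ _ _ h h' h₁ h₂) d hbd le_rfl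
  have hker : LinearMap.ker g = (V.pullSpace b d ⊥).comap (V.pullSpace b d ⊤).subtype := by
    ext ⟨x, hx⟩
    rw [LinearMap.mem_ker, Submodule.mem_comap]
    constructor
    · intro h
      obtain ⟨v, rfl, hv, -⟩ := id hx
      -- Deleting from `v` the bars that contain `d` makes the family end in `0`. It stays
      -- compatible, and its value at `b` is unchanged: the deleted coordinates that are present at
      -- `b` vanish there by assumption.
      refine ⟨fun j => C.vec j (fun a => if P a d then 0 else C.φ j (v j) a), ?_, ?_, ?_⟩
      · refine C.inj b (funext fun a => ?_)
        rw [φ_vec]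
        by_cases hb : P a b
        · rw [if_pos hb]
          split
          · next hd => exact (congrFun h ⟨a, hb, hd⟩).symm
          · rfl
        · rw [if_neg hb]
          exact (C.supp b (v b) a hb).symm
      · intro i hi hi'
        refine (C.rel i _ _).2 fun a ha => ?_
        have hr := (C.rel i _ _).1 (hv i hi hi') a ha
        rw [φ_vec, φ_vec]
        by_cases hd : P a d
        · simp [hd]
        · simp only [hd, if_false]
          rw [← hr]
          have h₁ : ¬P a (lo i) → C.φ (lo i) (v (lo i)) a = 0 := C.supp _ _ _
          have h₂ : ¬P a (Zigzag.hi i) → C.φ (lo i) (v (lo i)) a = 0 := by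
            rw [hr]; exact C.supp _ _ _
          split <;> split <;> simp_all
      · refine (Submodule.mem_bot F).2 (C.inj d (funext fun a => ?_))
        rw [φ_vec, map_zero]
        by_cases hd : P a d <;> simp [hd]
    · rintro ⟨v, rfl, hv, h0⟩
      refine funext fun ⟨a, ha⟩ => ?_
      have := hconst hv a ha.1 ha.2
      rw [(Submodule.mem_bot F).1 h0, map_zero] at this
      exact this.symm
  have hsurj : Function.Surjective g := by
    intro c
    let c' : ι → F := fun a => if h : P a b ∧ P a d then c ⟨a, h⟩ else 0
    refine ⟨⟨C.vec b c', fun j => C.vec j c', rfl, ?_, trivial⟩, ?_⟩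
    · intro i hi hi'
      refine (C.rel i _ _).2 fun a ha => ?_
      rw [φ_vec, φ_vec]
      by_cases h : P a b ∧ P a d
      · rw [if_pos, if_pos]
        · exact hP a _ _ _ (by simp [Fin.le_def, Zigzag.hi]; omega)
            (by simp [Fin.le_def, Zigzag.hi]; omega) h.1 h.2
        · exact hP a _ _ _ (by simp [Fin.le_def, lo]; omega)
            (by simp [Fin.le_def, lo]; omega) h.1 h.2
      · simp [c', h]
    · refine funext fun ⟨a, ha⟩ => ?_
      change C.φ b (C.vec b c') a = _
      rw [φ_vec, if_pos ha.1]
      simp [c', ha]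
  rw [relRank, ← hker, (g.quotKerEquivOfSurjective hsurj).finrank_eq, Module.finrank_pi,
    Nat.card_eq_fintype_card]

end Coords

/-- Inclusion–exclusion over the two ways of enlarging `[b + 1, d]` by one index, written without
subtraction. -/
theorem countP_succ_eq (D : Multiset (ℕ × ℕ)) (b d : ℕ) :
    D.count (b + 1, d) + D.countP (fun x => x.1 ≤ b ∧ d ≤ x.2) +
        D.countP (fun x => x.1 ≤ b + 1 ∧ d + 1 ≤ x.2) =
      D.countP (fun x => x.1 ≤ b + 1 ∧ d ≤ x.2) +
        D.countP (fun x => x.1 ≤ b ∧ d + 1 ≤ x.2) := by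
  induction D using Multiset.induction_on with
  | empty => simp
  | cons x D ih =>
    obtain ⟨p, q⟩ := x
    simp only [Multiset.count_cons, Multiset.countP_cons, Prod.mk.injEq]
    split_ifs <;> omega

/-- A multiset of pairs is determined by the numbers of its elements that contain a given
interval. -/
theorem eq_of_countP_eq {D E : Multiset (ℕ × ℕ)}
    (hD : ∀ x ∈ D, 1 ≤ x.1 ∧ x.1 ≤ x.2 ∧ x.2 ≤ n) (hE : ∀ x ∈ E, 1 ≤ x.1 ∧ x.1 ≤ x.2 ∧ x.2 ≤ n)
    (h : ∀ b d, 1 ≤ b → b ≤ d → d ≤ n →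
      D.countP (fun x => x.1 ≤ b ∧ d ≤ x.2) = E.countP (fun x => x.1 ≤ b ∧ d ≤ x.2)) :
    D = E := by
  -- Inclusion–exclusion also needs the counts at `b = 0` and `d = n + 1`, where both sides vanish.
  have h' : ∀ b d, b ≤ d →
      D.countP (fun x => x.1 ≤ b ∧ d ≤ x.2) = E.countP (fun x => x.1 ≤ b ∧ d ≤ x.2) := by
    intro b d hbd
    by_cases hb : 1 ≤ b ∧ d ≤ n
    · exact h b d hb.1 hbd hb.2
    · rw [Multiset.countP_eq_zero.2, Multiset.countP_eq_zero.2]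
      · intro x hx
        have := hE x hx
        omega
      · intro x hx
        have := hD x hx
        omega
  ext ⟨b, d⟩
  by_cases hbd : 1 ≤ b ∧ b ≤ d
  · obtain ⟨b, rfl⟩ := Nat.exists_eq_add_of_le' hbd.1
    have h₁ := countP_succ_eq D b d
    have h₂ := countP_succ_eq E b d
    have e₁ := h' b d (by omega)
    have e₂ := h' (b + 1) (d + 1) (by omega)
    have e₃ := h' (b + 1) d (by omega)
    have e₄ := h' b (d + 1) (by omega)
    omega
  · rw [Multiset.count_eq_zero_of_notMem, Multiset.count_eq_zero_of_notMem]
    · intro hx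
      have := hE _ hx
      omega
    · intro hx
      have := hD _ hx
      omega

theorem InBar.convex {x : ℕ × ℕ} (i j k : Fin n) (hij : i ≤ j) (hjk : j ≤ k) (hi : InBar x i)
    (hk : InBar x k) : InBar x j := by
  simp only [InBar, Fin.le_def] at *
  omega

/-- The multiset of bars of an interval decomposition is unique. -/
theorem Coords.map_bar_eq {V : ZModule F n} {ι κ : Type} [Fintype ι] [Fintype κ]
    {bar : ι → ℕ × ℕ} {bar' : κ → ℕ × ℕ}
    (C : Coords V (fun a => InBar (bar a))) (D : Coords V (fun a => InBar (bar' a)))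
    (hb : ∀ a, 1 ≤ (bar a).1 ∧ (bar a).1 ≤ (bar a).2 ∧ (bar a).2 ≤ n)
    (hb' : ∀ a, 1 ≤ (bar' a).1 ∧ (bar' a).1 ≤ (bar' a).2 ∧ (bar' a).2 ≤ n) :
    Finset.univ.val.map bar = Finset.univ.val.map bar' := by
  refine eq_of_countP_eq (n := n) (by simpa using hb) (by simpa using hb') fun b d h₁ h₂ h₃ => ?_
  -- The right-hand side does not mention the coordinates. The index `b` is the position `b - 1`.
  have key : ∀ {ι : Type} [Fintype ι] {bar : ι → ℕ × ℕ}, Coords V (fun a => InBar (bar a)) →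
      (Finset.univ.val.map bar).countP (fun x => x.1 ≤ b ∧ d ≤ x.2) =
        V.relRank ⟨b - 1, by omega⟩ ⟨d - 1, by omega⟩ := by
    intro ι _ bar C
    rw [C.relRank_eq (fun a => InBar.convex) (by simp [Fin.le_def]; omega), Multiset.countP_map,
      Nat.subtype_card (Finset.univ.filter fun a => (bar a).1 ≤ b ∧ d ≤ (bar a).2)]
    · rfl
    · intro a
      simp only [Finset.mem_filter, Finset.mem_univ, true_and, InBar]
      omega
  rw [key C, key D]

/-- Serves to pass between bars indexed by an arbitrary finite type and the occurrences of points in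
a diagram. -/
theorem exists_equiv_toType {ι α : Type*} [Fintype ι] [DecidableEq α] (f : ι → α)
    {D : Multiset α} (hD : Finset.univ.val.map f = D) : ∃ e : D.ToType ≃ ι, ∀ x, f (e x) = x.1 := by
  classical
  subst hD
  have hb : Function.Bijective (fun x : (Finset.univ.val : Multiset ι).ToType => x.1) := by
    constructor
    · rintro ⟨x, i⟩ ⟨y, j⟩ h
      obtain rfl : x = y := h
      have hi := i.2
      have hj := j.2
      have hc := Multiset.nodup_iff_count_le_one.mp (Finset.univ : Finset ι).nodup x
      congr 1
      ext
      omega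
    · intro x
      exact ⟨⟨x, 0, Multiset.count_pos.mpr (Finset.mem_univ x)⟩, rfl⟩
  refine ⟨((Finset.univ.val : Multiset ι).mapEquiv f).symm.trans (Equiv.ofBijective _ hb),
    fun x => ?_⟩
  obtain ⟨y, rfl⟩ := ((Finset.univ.val : Multiset ι).mapEquiv f).surjective x
  simp [Multiset.mapEquiv_apply]

theorem Coords.isDecomposition {V : ZModule F n} {ι : Type} [Fintype ι] {bar : ι → ℕ × ℕ}
    (C : Coords V (fun a => InBar (bar a)))
    (hb : ∀ a, 1 ≤ (bar a).1 ∧ (bar a).1 ≤ (bar a).2 ∧ (bar a).2 ≤ n) :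
    V.IsDecomposition (Finset.univ.val.map bar) := by
  refine ⟨by simpa using hb, ?_⟩
  obtain ⟨e, he⟩ := exists_equiv_toType bar rfl
  exact (C.reindex e fun a j => by rw [he]).iso (Coords.ofIntervalSum _ _)
    (directSum_type ..).symm

theorem IsDecomposition.nonempty_coords {V : ZModule F n} {D : Multiset (ℕ × ℕ)}
    (h : V.IsDecomposition D) : Nonempty (Coords V (fun a : D.ToType => InBar a.1)) :=
  (Coords.ofIntervalSum _ _).nonempty_of_iso h.2

theorem IsDecomposition.eq {V : ZModule F n} {D E : Multiset (ℕ × ℕ)} (hD : V.IsDecomposition D)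
    (hE : V.IsDecomposition E) : D = E := by
  obtain ⟨C⟩ := hD.nonempty_coords
  obtain ⟨C'⟩ := hE.nonempty_coords
  have := C.map_bar_eq C' (fun a => hD.1 _ (Multiset.coe_mem)) (fun a => hE.1 _ Multiset.coe_mem)
  exact (Multiset.map_univ_coe D).symm.trans (this.trans (Multiset.map_univ_coe E))

theorem IsDecomposition.dgm_eq {V : ZModule F n} {D : Multiset (ℕ × ℕ)}
    (h : V.IsDecomposition D) : V.dgm = D := by
  have hex : ∃ D, V.IsDecomposition D := ⟨D, h⟩
  rw [dgm, dif_pos hex]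
  exact hex.choose_spec.eq h

end ZModule

/-! ### Existence of interval decompositions -/

namespace Arrow

variable {F : Type u} [Field F] {X Y : FDSpace F}

theorem rel_sub (a : Arrow X Y) {x x' : X} {y y' : Y} (h : a.Rel x y) (h' : a.Rel x' y') :
    a.Rel (x - x') (y - y') := by
  cases a <;> simp_all [Rel]

/-- A functional on the left space extends along an arrow to the right space, with prescribed
zeros `S`, if this is compatible with the arrow. -/
theorem exists_dual_extension (a : Arrow X Y) (f : X →ₗ[F] F) (S : Submodule F Y)
    (h : ∀ x, ∀ y ∈ S, a.Rel x y → f x = 0) :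
    ∃ g : Y →ₗ[F] F, S ≤ LinearMap.ker g ∧ ∀ x y, a.Rel x y → f x = g y := by
  cases a with
  | bwd p =>
    exact ⟨f ∘ₗ p, fun y hy => h _ y hy rfl, fun x y hxy => by rw [← show p y = x from hxy]; rfl⟩
  | fwd p =>
    -- Over a field, a functional factors through a linear map as soon as it vanishes on the kernel;
    -- here the map is `p` followed by the quotient by `S`.
    have hf : f ∈ (LinearMap.ker (S.mkQ ∘ₗ p)).dualAnnihilator := by
      rw [Submodule.mem_dualAnnihilator]
      intro x hx
      refine h x (p x) ?_ rfl
      simpa using hx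
    rw [← LinearMap.range_dualMap_eq_dualAnnihilator_ker] at hf
    obtain ⟨g, rfl⟩ := hf
    refine ⟨g ∘ₗ S.mkQ, fun y hy => ?_, fun x y hxy => ?_⟩
    · simp [(Submodule.Quotient.mk_eq_zero S).2 hy]
    · rw [← show p x = y from hxy]
      rfl

/-- Restriction of an arrow to the kernels of two functionals. -/
def restrictKer (a : Arrow X Y) (f : X →ₗ[F] F) (g : Y →ₗ[F] F)
    (h₁ : a.dir = Dir.fwd → ∀ x y, a.Rel x y → f x = 0 → g y = 0)
    (h₂ : a.dir = Dir.bwd → ∀ x y, a.Rel x y → g y = 0 → f x = 0) :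
    Arrow (⟨LinearMap.ker f⟩ : FDSpace F) ⟨LinearMap.ker g⟩ :=
  match a with
  | fwd p => fwd (p.restrict fun x hx => h₁ rfl x (p x) rfl hx)
  | bwd p => bwd (p.restrict fun y hy => h₂ rfl (p y) y rfl hy)

theorem restrictKer_dir (a : Arrow X Y) (f : X →ₗ[F] F) (g : Y →ₗ[F] F)
    (h₁ : a.dir = Dir.fwd → ∀ x y, a.Rel x y → f x = 0 → g y = 0)
    (h₂ : a.dir = Dir.bwd → ∀ x y, a.Rel x y → g y = 0 → f x = 0) :
    (a.restrictKer f g h₁ h₂).dir = a.dir := by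
  cases a <;> rfl

theorem restrictKer_rel (a : Arrow X Y) (f : X →ₗ[F] F) (g : Y →ₗ[F] F)
    (h₁ : a.dir = Dir.fwd → ∀ x y, a.Rel x y → f x = 0 → g y = 0)
    (h₂ : a.dir = Dir.bwd → ∀ x y, a.Rel x y → g y = 0 → f x = 0)
    (x : LinearMap.ker f) (y : LinearMap.ker g) :
    (a.restrictKer f g h₁ h₂).Rel x y ↔ a.Rel x.1 y.1 := by
  cases a <;> exact Subtype.ext_iff

end Arrow

namespace ZModule

variable {F : Type u} [Field F] {n : ℕ}

/-- The family `f` of functionals is compatible with the arrows between `b` and `m`. -/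
def Cocompat (V : ZModule F n) (b m : ℕ) (f : ∀ j, V.space j →ₗ[F] F) : Prop :=
  ∀ i : Fin (n - 1), b ≤ i.1 → i.1 < m → ∀ x y, (V.arrow i).Rel x y → f (lo i) x = f (hi i) y

theorem Compat.update {V : ZModule F n} {b : ℕ} {i : Fin (n - 1)} {v : ∀ j, V.space j}
    (hv : V.Compat b (lo i).1 v) {y : V.space (hi i)} (hy : (V.arrow i).Rel (v (lo i)) y) :
    V.Compat b (hi i).1 (Function.update v (hi i) y) := by
  intro k hbk hk
  have hlo : ∀ k : Fin (n - 1), k.1 ≤ i.1 → lo k ≠ hi i := fun k hk h => by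
    have := congrArg Fin.val h
    simp [lo, hi] at this
    omega
  simp only [hi] at hk
  rw [Function.update_of_ne (hlo k (by omega))]
  by_cases hki : k = i
  · subst hki
    rwa [Function.update_self]
  · have : hi k ≠ hi i := fun h => hki (by
      have := congrArg Fin.val h
      simp [hi] at this
      exact Fin.ext this)
    rw [Function.update_of_ne this]
    have : k.1 ≠ i.1 := fun h => hki (Fin.ext h)
    exact hv k hbk (by simp only [lo]; omega)

theorem pullSpace_succ {V : ZModule F n} {b : Fin n} {i : Fin (n - 1)} (hb : b ≤ lo i)
    {S : Submodule F (V.space (lo i))} {S' : Submodule F (V.space (hi i))}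
    (h : ∀ x ∈ S, ∃ y ∈ S', (V.arrow i).Rel x y) :
    V.pullSpace b (lo i) S ≤ V.pullSpace b (hi i) S' := by
  rintro _ ⟨v, rfl, hv, hS⟩
  obtain ⟨y, hy, hr⟩ := h _ hS
  refine ⟨Function.update v (hi i) y, ?_, hv.update hr, ?_⟩
  · refine Function.update_of_ne (fun h => ?_) ..
    have h₁ : b.1 ≤ i.1 := hb
    have h₂ : b.1 = i.1 + 1 := congrArg Fin.val h
    omega
  · rwa [Function.update_self]

/-- Duality for linear relations: a functional at `b` that kills every vector transportable into `S`
at `m` is itself transportable to a functional at `m` that kills `S`. The induction pulls `S` back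
along the last arrow and then extends the functional over this arrow. -/
theorem exists_cocompat (V : ZModule F n) (b m : Fin n) (hbm : b ≤ m)
    (S : Submodule F (V.space m)) (f₀ : V.space b →ₗ[F] F)
    (hf : V.pullSpace b m S ≤ LinearMap.ker f₀) :
    ∃ f : ∀ j, V.space j →ₗ[F] F, f b = f₀ ∧ V.Cocompat b m f ∧ S ≤ LinearMap.ker (f m) := by
  obtain ⟨m, hm⟩ := m
  have base : ∀ (S : Submodule F (V.space b)), V.pullSpace b b S ≤ LinearMap.ker f₀ →
      ∃ f : ∀ j, V.space j →ₗ[F] F, f b = f₀ ∧ V.Cocompat b b f ∧ S ≤ LinearMap.ker (f b) := by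
    intro S hf
    refine ⟨Pi.single b f₀, by simp, fun i h h' => absurd h' (by omega), ?_⟩
    rw [Pi.single_eq_same]
    refine fun x hx => hf (show x ∈ V.pullSpace b b S from ?_)
    exact ⟨Pi.single b x, by simp, fun i h h' => absurd h' (by omega), by simpa⟩
  induction m with
  | zero =>
    obtain rfl : b = ⟨0, hm⟩ := le_antisymm hbm (Nat.zero_le _)
    exact base S hf
  | succ m ih =>
    rcases hbm.eq_or_lt with h | h
    · subst h
      exact base S hf
    · let i : Fin (n - 1) := ⟨m, by omega⟩
      have hb : b ≤ lo i := Nat.lt_succ_iff.mp h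
      let S' : Submodule F (V.space (lo i)) :=
        { carrier := {x | ∃ y : V.space (hi i), y ∈ S ∧ (V.arrow i).Rel x y}
          zero_mem' := ⟨0, S.zero_mem, Arrow.rel_zero _⟩
          add_mem' := by
            rintro x x' ⟨y, hy, hxy⟩ ⟨y', hy', hxy'⟩
            exact ⟨y + y', S.add_mem hy hy', Arrow.rel_add _ hxy hxy'⟩
          smul_mem' := by
            rintro r x ⟨y, hy, hxy⟩
            exact ⟨r • y, S.smul_mem r hy, Arrow.rel_smul _ r hxy⟩ }
      obtain ⟨f, hfb, hfc, hfS⟩ := ih (by omega) hb S'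
        (le_trans (pullSpace_succ hb fun x hx => hx) hf)
      obtain ⟨g, hgS, hg⟩ := (V.arrow i).exists_dual_extension (f (lo i)) S
        fun x y hy hxy => hfS ⟨y, hy, hxy⟩
      refine ⟨Function.update f (hi i) g, ?_, ?_, ?_⟩
      · rw [← hfb]
        exact Function.update_of_ne h.ne ..
      · intro k hbk hk x y hxy
        have hk' : k.1 < m + 1 := hk
        have hlo : lo k ≠ hi i := fun h => by
          have : k.1 = m + 1 := congrArg Fin.val h
          omega
        rw [Function.update_of_ne hlo]
        by_cases hki : k = i
        · subst hki
          rw [Function.update_self]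
          exact hg x y hxy
        · have hne : hi k ≠ hi i := fun h => hki (by
            have : k.1 + 1 = i.1 + 1 := congrArg Fin.val h
            exact Fin.ext (by omega))
          rw [Function.update_of_ne hne]
          have : k.1 ≠ m := fun h => hki (Fin.ext h)
          exact hfc k hbk (by simp only; omega) x y hxy
      · intro y hy
        change Function.update f (hi i) g (hi i) y = 0
        rw [Function.update_self]
        exact hgS hy

/-- A space different from zero at position `b` supports a compatible family and a compatible
family of functionals on some `[b, m]` that pair to `1` and satisfy the boundary conditions
at `m` for morphisms from and to the interval module on `[b, m]`. -/
theorem exists_compat_cocompat (V : ZModule F n) (b : Fin n) [Nontrivial (V.space b)] :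
    ∃ (m : Fin n) (v : ∀ j, V.space j) (f : ∀ j, V.space j →ₗ[F] F), b ≤ m ∧
      V.Compat b m v ∧ V.Cocompat b m f ∧ f b (v b) = 1 ∧
      ∀ i : Fin (n - 1), i.1 = m.1 → (V.type i = Dir.fwd → (V.arrow i).Rel (v (lo i)) 0) ∧
        (V.type i = Dir.bwd → ∀ x y, (V.arrow i).Rel x y → f (lo i) x = 0) := by
  -- The interval ends at the last `m` for which the linear relation from `b` to `m` has nonzero
  -- rank.
  have hne : ({m : Fin n | b ≤ m ∧ ¬V.pullSpace b m ⊤ ≤ V.pullSpace b m ⊥}).Nonempty := by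
    refine ⟨b, le_rfl, fun h => ?_⟩
    obtain ⟨x, hx⟩ := exists_ne (0 : V.space b)
    have hmem : x ∈ V.pullSpace b b ⊤ :=
      ⟨Pi.single b x, by simp, fun i h h' => absurd h' (by omega), trivial⟩
    obtain ⟨v, hv, -, h0⟩ := h hmem
    exact hx (hv.symm.trans ((Submodule.mem_bot F).1 h0))
  obtain ⟨m, ⟨hbm, hm⟩, hmax⟩ := Set.exists_max_image _ id (Set.toFinite _) hne
  -- A vector outside `pullSpace b m S` is detected by a functional vanishing on that subspace; it
  -- is rescaled to take the value `1` and then transported to `m`.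
  have finish : ∀ (S : Submodule F (V.space m)) (v : ∀ j, V.space j), V.Compat b m v →
      v b ∉ V.pullSpace b m S → ∃ f : ∀ j, V.space j →ₗ[F] F, V.Cocompat b m f ∧
        f b (v b) = 1 ∧ S ≤ LinearMap.ker (f m) := by
    intro S v hv hvS
    obtain ⟨f₀, h0, hf₀⟩ := Submodule.exists_le_ker_of_notMem hvS
    obtain ⟨f, hfb, hf, hS⟩ := V.exists_cocompat b m hbm S ((f₀ (v b))⁻¹ • f₀)
      (fun x hx => by simp [LinearMap.mem_ker.1 (hf₀ hx)])
    exact ⟨f, hf, by simp [hfb, h0], hS⟩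
  obtain ⟨x, hx, hx'⟩ := Set.not_subset.mp hm
  by_cases hlast : m.1 + 1 = n
  · obtain ⟨v, rfl, hv, -⟩ := hx
    obtain ⟨f, hf, h1, -⟩ := finish ⊥ v hv hx'
    exact ⟨m, v, f, hbm, hv, hf, h1, fun i hi => absurd i.2 (by omega)⟩
  · obtain ⟨i, rfl⟩ : ∃ i : Fin (n - 1), m = lo i := ⟨⟨m.1, by omega⟩, rfl⟩
    have hlt : lo i < hi i := Nat.lt_succ_self _
    have hsucc : V.pullSpace b (hi i) ⊤ ≤ V.pullSpace b (hi i) ⊥ := by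
      by_contra hcon
      exact absurd (hmax (hi i) ⟨hbm.trans hlt.le, hcon⟩) (not_le.2 hlt)
    have huniq : ∀ k : Fin (n - 1), k.1 = (lo i).1 → k = i := fun k hk => Fin.ext hk
    cases ha : V.arrow i with
    | fwd p =>
      have ht : V.type i = Dir.fwd := by simp [type, ha, Arrow.dir]
      -- Along a forward arrow every family extends to the next position. By maximality of `m` there
      -- is then a family with the same start that is `0` at the next position, and this one is
      -- used.
      obtain ⟨v, rfl, hv, h0⟩ := hsucc (pullSpace_succ (S' := ⊤) hbm
        (fun x _ => ⟨p x, trivial, by rw [ha]; rfl⟩) hx)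
      have hv' : V.Compat b (lo i) v := fun k h h' => hv k h (h'.trans hlt)
      obtain ⟨f, hf, h1, -⟩ := finish ⊥ v hv' hx'
      refine ⟨lo i, v, f, hbm, hv', hf, h1, fun k hk => ?_⟩
      obtain rfl := huniq k hk
      refine ⟨fun _ => ?_, fun h => ?_⟩
      · rw [← (Submodule.mem_bot F).1 h0]
        exact hv k hbm hlt
      · rw [ht] at h
        cases h
    | bwd p =>
      have ht : V.type i = Dir.bwd := by simp [type, ha, Arrow.dir]
      obtain ⟨v, rfl, hv, -⟩ := hx
      -- The functional has to vanish on the image of the backward map. A family ending in this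
      -- image would extend by one position; by maximality it could be replaced by one that is `0`
      -- there, hence also `0` at `m`, contradicting the choice of `v b`.
      have hx'' : v b ∉ V.pullSpace b (lo i) (LinearMap.range p) := by
        intro h
        refine hx' ?_
        obtain ⟨w, hwb, hw, h0⟩ := hsucc (pullSpace_succ (S := LinearMap.range p) (S' := ⊤) hbm
          (by rintro _ ⟨y, rfl⟩; exact ⟨y, trivial, by rw [ha]; rfl⟩) h)
        refine ⟨w, hwb, fun k h h' => hw k h (h'.trans hlt), ?_⟩
        have hr := hw i hbm hlt
        rw [(Submodule.mem_bot F).1 h0, ha] at hr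
        rw [← show p 0 = w (lo i) from hr, map_zero]
        exact Submodule.zero_mem _
      obtain ⟨f, hf, h1, hS⟩ := finish _ v hv hx''
      refine ⟨lo i, v, f, hbm, hv, hf, h1, fun k hk => ?_⟩
      obtain rfl := huniq k hk
      refine ⟨fun h => ?_, fun _ x y hxy => ?_⟩
      · rw [ht] at h
        cases h
      · rw [ha] at hxy
        exact hS ⟨y, hxy⟩

/-- A summand of `V` that is the field on `Q`, given by its inclusion `v` and projection `f`. -/
structure Splitting (V : ZModule F n) (Q : Fin n → Prop) where
  v : ∀ j, V.space j
  f : ∀ j, V.space j →ₗ[F] F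
  v_zero : ∀ j, ¬Q j → v j = 0
  f_zero : ∀ j, ¬Q j → f j = 0
  f_v : ∀ j, Q j → f j (v j) = 1
  -- Tested at the source, the condition says that `v` is a morphism from the interval module;
  -- `f_rel`, tested at the target, says that `f` is a morphism to it.
  v_rel : ∀ i, Q (src (V.type i) i) → (V.arrow i).Rel (v (lo i)) (v (hi i))
  f_rel : ∀ i x y, (V.arrow i).Rel x y → Q (tgt (V.type i) i) → f (lo i) x = f (hi i) y

namespace Splitting

variable {V : ZModule F n} {Q : Fin n → Prop}

/-- The complement of the summand. -/
def compl (s : V.Splitting Q) : ZModule F n where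
  space j := ⟨LinearMap.ker (s.f j)⟩
  arrow i := (V.arrow i).restrictKer (s.f (lo i)) (s.f (hi i))
    (fun h x y hxy h0 => by
      by_cases hQ : Q (hi i)
      · rw [← s.f_rel i x y hxy (by rw [show V.type i = Dir.fwd from h]; exact hQ), h0]
      · rw [s.f_zero _ hQ]; rfl)
    (fun h x y hxy h0 => by
      by_cases hQ : Q (lo i)
      · rw [s.f_rel i x y hxy (by rw [show V.type i = Dir.bwd from h]; exact hQ), h0]
      · rw [s.f_zero _ hQ]; rfl)

theorem compl_type (s : V.Splitting Q) : s.compl.type = V.type :=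
  funext fun _ => Arrow.restrictKer_dir ..

/-- The projection to the complement. -/
def toCompl (s : V.Splitting Q) (j : Fin n) : V.space j →ₗ[F] s.compl.space j :=
  LinearMap.codRestrict (LinearMap.ker (s.f j))
    (LinearMap.id - (s.f j).smulRight (s.v j)) fun x => by
      by_cases hQ : Q j
      · simp [s.f_v j hQ]
      · simp [s.f_zero j hQ]

theorem rel_smul_v (s : V.Splitting Q) (i : Fin (n - 1)) (x : V.space (lo i))
    (y : V.space (hi i)) (h : Q (tgt (V.type i) i) → s.f (lo i) x = s.f (hi i) y) :
    (V.arrow i).Rel (s.f (lo i) x • s.v (lo i)) (s.f (hi i) y • s.v (hi i)) := by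
  have hv := s.v_rel i
  have hl : ¬Q (lo i) → s.f (lo i) x = 0 ∧ s.v (lo i) = 0 := fun hQ =>
    ⟨by rw [s.f_zero _ hQ]; rfl, s.v_zero _ hQ⟩
  have hh : ¬Q (hi i) → s.f (hi i) y = 0 ∧ s.v (hi i) = 0 := fun hQ =>
    ⟨by rw [s.f_zero _ hQ]; rfl, s.v_zero _ hQ⟩
  simp only [type] at h hv
  by_cases h₁ : Q (lo i) <;> by_cases h₂ : Q (hi i) <;> cases ha : V.arrow i <;>
    simp_all [Arrow.Rel, Arrow.dir, tgt, src]
  rw [← h, zero_smul]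

/-- The components along `v` of a related pair are themselves related, so subtracting them splits
the relation into the one of the interval and the one of the complement. -/
theorem rel_iff (s : V.Splitting Q) (i : Fin (n - 1)) (x : V.space (lo i))
    (y : V.space (hi i)) :
    (V.arrow i).Rel x y ↔ (Q (tgt (V.type i) i) → s.f (lo i) x = s.f (hi i) y) ∧
      (s.compl.arrow i).Rel (s.toCompl (lo i) x) (s.toCompl (hi i) y) := by
  have key : (s.compl.arrow i).Rel (s.toCompl (lo i) x) (s.toCompl (hi i) y) ↔
      (V.arrow i).Rel (x - s.f (lo i) x • s.v (lo i)) (y - s.f (hi i) y • s.v (hi i)) :=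
    Arrow.restrictKer_rel ..
  rw [key]
  constructor
  · exact fun h => ⟨s.f_rel i x y h, Arrow.rel_sub _ h (s.rel_smul_v i x y (s.f_rel i x y h))⟩
  · rintro ⟨h, h'⟩
    simpa using Arrow.rel_add _ h' (s.rel_smul_v i x y h)

/-- Coordinates of the complement extend to coordinates of the whole module. -/
def coords (s : V.Splitting Q) {ι : Type} {P : ι → Fin n → Prop} (C : Coords s.compl P) :
    Coords V (fun a : Option ι => a.elim Q P) where
  φ j := LinearMap.pi (Option.rec (s.f j) fun a => LinearMap.proj a ∘ₗ C.φ j ∘ₗ s.toCompl j)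
  inj j := by
    rw [injective_iff_map_eq_zero]
    intro x hx
    have h0 : s.f j x = 0 := congrFun hx none
    have h1 : s.toCompl j x = 0 := by
      refine C.inj j (funext fun a => ?_)
      rw [map_zero]
      exact congrFun hx (some a)
    have h2 : x - s.f j x • s.v j = 0 := congrArg Subtype.val h1
    simpa [h0] using h2
  surj j c hc := by
    obtain ⟨u, hu⟩ := C.surj j (fun a => c (some a)) fun a ha => hc (some a) ha
    have hu0 : s.f j u.1 = 0 := u.2
    have hf : s.f j (u.1 + c none • s.v j) = c none := by
      by_cases hQ : Q j
      · simp [s.f_v j hQ, hu0]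
      · simp [s.f_zero j hQ, hc none hQ]
    refine ⟨u.1 + c none • s.v j, funext fun a => ?_⟩
    cases a with
    | none => exact hf
    | some a =>
      rw [← congrFun hu a]
      refine congrFun (congrArg (C.φ j) (Subtype.ext ?_)) a
      change u.1 + c none • s.v j - s.f j (u.1 + c none • s.v j) • s.v j = u.1
      rw [hf, add_sub_cancel_right]
  supp j x a ha := by
    cases a with
    | none =>
      change s.f j x = 0
      rw [s.f_zero j ha]
      rfl
    | some a => exact C.supp j _ a ha
  rel i x y := by
    rw [s.rel_iff, C.rel, s.compl_type, Option.forall]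
    rfl

end Splitting

/-- The families of `exists_compat_cocompat` are cut off outside `[b, m]`. Their boundary conditions
take care of the right end; at the left end the neighbouring space is zero because `b` is leftmost.
-/
theorem exists_splitting (V : ZModule F n) (b : Fin n) [Nontrivial (V.space b)]
    (hb : ∀ j < b, Subsingleton (V.space j)) :
    ∃ m, b ≤ m ∧ Nonempty (V.Splitting fun j => b ≤ j ∧ j ≤ m) := by
  classical
  obtain ⟨m, v, f, hbm, hv, hf, h1, hend⟩ := V.exists_compat_cocompat b
  refine ⟨m, hbm, ⟨⟨fun j => if b ≤ j ∧ j ≤ m then v j else 0,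
    fun j => if b ≤ j ∧ j ≤ m then f j else 0, fun j hj => if_neg hj, fun j hj => if_neg hj,
    fun j hj => ?_, fun i hi => ?_, fun i x y hxy hi => ?_⟩⟩⟩
  · rw [if_pos hj, if_pos hj]
    obtain ⟨j, hjn⟩ := j
    induction j with
    | zero =>
      obtain rfl : b = ⟨0, hjn⟩ := le_antisymm hj.1 (Nat.zero_le _)
      exact h1
    | succ j ih =>
      rcases hj.1.eq_or_lt with h | h
      · subst h
        exact h1
      · have hbj : b.1 ≤ j := Nat.lt_succ_iff.mp h
        have hjm : j + 1 ≤ m.1 := hj.2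
        rw [← ih (by omega) ⟨hbj, by simp [Fin.le_def]; omega⟩]
        exact (hf ⟨j, by omega⟩ hbj (by simp; omega) _ _
          (hv ⟨j, by omega⟩ hbj (by simp; omega))).symm
  · have hlo : (lo i).1 = i.1 := rfl
    have hhi : (Zigzag.hi i).1 = i.1 + 1 := rfl
    simp only [Fin.le_def, hlo, hhi] at hi ⊢
    cases ht : V.type i with
    | fwd =>
      simp only [ht, src, hlo] at hi
      rw [if_pos hi]
      split
      · exact hv i (by omega) (by omega)
      · exact (hend i (by omega)).1 ht
    | bwd =>
      simp only [ht, src, hhi] at hi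
      rw [if_pos hi]
      split
      · exact hv i (by omega) (by omega)
      · have := hb (lo i) (by simp only [Fin.lt_def, hlo]; omega)
        cases ha : V.arrow i with
        | fwd p => simp [type, ha, Arrow.dir] at ht
        | bwd p => exact Subsingleton.elim _ _
  · have hlo : (lo i).1 = i.1 := rfl
    have hhi : (Zigzag.hi i).1 = i.1 + 1 := rfl
    simp only [Fin.le_def, hlo, hhi] at hi ⊢
    cases ht : V.type i with
    | fwd =>
      simp only [ht, tgt, hhi] at hi
      rw [if_pos hi]
      split
      · exact hf i (by omega) (by omega) x y hxy
      · have := hb (lo i) (by simp only [Fin.lt_def, hlo]; omega)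
        cases ha : V.arrow i with
        | fwd p =>
          rw [ha] at hxy
          rw [← show p x = y from hxy, Subsingleton.elim x 0]
          simp
        | bwd p => simp [type, ha, Arrow.dir] at ht
    | bwd =>
      simp only [ht, tgt, hlo] at hi
      rw [if_pos hi]
      split
      · exact hf i (by omega) (by omega) x y hxy
      · exact (hend i (by omega)).2 ht x y hxy

/-- Coordinates of the zero module. -/
def Coords.ofSubsingleton (V : ZModule F n) (hV : ∀ j, Subsingleton (V.space j)) {ι : Type}
    [IsEmpty ι] (P : ι → Fin n → Prop) : Coords V P where
  φ j := 0
  inj j x y _ := have := hV j; Subsingleton.elim x y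
  surj j c _ := ⟨0, funext isEmptyElim⟩
  supp j v := isEmptyElim
  rel i x y := by
    have h₁ := hV (lo i)
    have h₂ := hV (hi i)
    rw [Subsingleton.elim x 0, Subsingleton.elim y 0]
    exact ⟨fun _ => isEmptyElim, fun _ => Arrow.rel_zero _⟩

/-- Induction on the total dimension: an interval that starts at the leftmost nonzero space splits
off, and the complement is strictly smaller at that position. -/
theorem exists_coords (V : ZModule F n) : ∃ (ι : Type) (_ : Fintype ι) (bar : ι → ℕ × ℕ),
    (∀ a, 1 ≤ (bar a).1 ∧ (bar a).1 ≤ (bar a).2 ∧ (bar a).2 ≤ n) ∧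
      Nonempty (Coords V (fun a => InBar (bar a))) := by
  generalize hN : ∑ j, Module.finrank F (V.space j) = N
  induction N using Nat.strong_induction_on generalizing V with
  | _ N ih =>
    by_cases hV : ∀ j, Subsingleton (V.space j)
    · exact ⟨Empty, inferInstance, isEmptyElim, isEmptyElim,
        ⟨Coords.ofSubsingleton V hV _⟩⟩
    · push Not at hV
      obtain ⟨b, hb, hmin⟩ := Set.exists_min_image
        {j | Nontrivial (V.space j)} id (Set.toFinite _) hV
      have : Nontrivial (V.space b) := hb
      obtain ⟨m, hbm, ⟨s⟩⟩ := V.exists_splitting b fun j hj => by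
        by_contra h
        rw [not_subsingleton_iff_nontrivial] at h
        exact absurd (hmin j h) (not_le.2 hj)
      have hlt : ∑ j, Module.finrank F (s.compl.space j) < N := by
        rw [← hN]
        refine Finset.sum_lt_sum (fun j _ => Submodule.finrank_le (LinearMap.ker (s.f j)))
          ⟨b, Finset.mem_univ _, ?_⟩
        refine Submodule.finrank_lt (s := LinearMap.ker (s.f b)) fun h => ?_
        have h1 := s.f_v b ⟨le_rfl, hbm⟩
        rw [LinearMap.ker_eq_top.1 h] at h1
        simp at h1
      obtain ⟨ι, hι, bar, hbar, ⟨C⟩⟩ := ih _ hlt s.compl rfl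
      refine ⟨Option ι, inferInstance, fun a => a.elim (b.1 + 1, m.1 + 1) bar, ?_,
        ⟨(s.coords C).reindex (Equiv.refl _) ?_⟩⟩
      · rintro (_ | a)
        · have h₁ : b.1 ≤ m.1 := hbm
          have h₂ := m.2
          simp only [Option.elim]
          omega
        · exact hbar a
      · rintro (_ | a) j
        · change b.1 + 1 ≤ j.1 + 1 ∧ j.1 + 1 ≤ m.1 + 1 ↔ b.1 ≤ j.1 ∧ j.1 ≤ m.1
          omega
        · rfl

theorem isDecomposition_dgm (V : ZModule F n) : V.IsDecomposition V.dgm := by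
  obtain ⟨ι, _, bar, hbar, ⟨C⟩⟩ := V.exists_coords
  have h := C.isDecomposition hbar
  rwa [h.dgm_eq]

end ZModule

/-! ### Reflections in coordinates -/

namespace ZModule

variable {F : Type u} [Field F] {n : ℕ}

theorem ne_of_hi_eq {i : Fin (n - 1)} {k : Fin n} (h : hi i = k) : lo i ≠ k :=
  fun h' => lo_ne_hi i (h'.trans h.symm)

theorem ne_of_lo_eq {i : Fin (n - 1)} {k : Fin n} (h : lo i = k) : hi i ≠ k :=
  fun h' => lo_ne_hi i (h.trans h'.symm)

theorem mem_nbr_of_hi_eq {i : Fin (n - 1)} {k : Fin n} (h : hi i = k) :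
    k.1 ≤ (lo i).1 + 1 ∧ (lo i).1 ≤ k.1 + 1 := by
  subst h; simp [lo, hi]; omega

theorem mem_nbr_of_lo_eq {i : Fin (n - 1)} {k : Fin n} (h : lo i = k) :
    k.1 ≤ (hi i).1 + 1 ∧ (hi i).1 ≤ k.1 + 1 := by
  subst h; simp [lo, hi]; omega

/-- A function on the neighbours of `k` that agrees at adjacent positions of a convex set is
constant on that set. -/
theorem eq_of_mem_nbr {α : Type*} {k : Fin n} {p : Fin n → Prop}
    (hp : ∀ i j l, i ≤ j → j ≤ l → p i → p l → p j) (g : Nbr k → α)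
    (h : ∀ (i : Fin (n - 1)) h₁ h₂, p (lo i) → p (hi i) → g ⟨lo i, h₁⟩ = g ⟨hi i, h₂⟩)
    (j j' : Nbr k) (hj : p j.1) (hj' : p j'.1) : g j = g j' := by
  have adj : ∀ j j' : Nbr k, j'.1.1 = j.1.1 + 1 → p j.1 → p j'.1 → g j = g j' := by
    rintro ⟨⟨j, hjn⟩, h₁⟩ ⟨⟨j', hjn'⟩, h₂⟩ heq hj hj'
    obtain rfl : j' = j + 1 := heq
    exact h ⟨j, by omega⟩ h₁ h₂ hj hj'
  have le : ∀ j j' : Nbr k, j.1.1 ≤ j'.1.1 → p j.1 → p j'.1 → g j = g j' := by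
    intro j j' hle hj hj'
    have h₁ := j.2
    have h₂ := j'.2
    rcases (show j'.1.1 = j.1.1 ∨ j'.1.1 = j.1.1 + 1 ∨ j'.1.1 = j.1.1 + 2 by omega) with
      h0 | h0 | h0
    · rw [show j' = j from Subtype.ext (Fin.ext h0)]
    · exact adj j j' h0 hj hj'
    · have hm : p k := hp j.1 k j'.1 (by rw [Fin.le_def]; omega)
        (by rw [Fin.le_def]; omega) hj hj'
      exact (adj j (Nbr.self k) (by change k.1 = _; omega) hj hm).trans
        (adj (Nbr.self k) j' (by change _ = k.1 + 1; omega) hm hj')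
  rcases le_total j.1.1 j'.1.1 with hle | hle
  · exact le j j' hle hj hj'
  · exact (le j' j hle hj' hj).symm

/-- Whether the limit around `k` of the module of type `τ` that is the field on `p` is nonzero. -/
def ExtAlive (τ : ZType n) (k : Fin n) (e : Dir) (p : Fin n → Prop) : Prop :=
  (∃ j : Nbr k, p j.1) ∧
    (∀ i : Fin (n - 1), k.1 ≤ (lo i).1 + 1 ∧ (lo i).1 ≤ k.1 + 1 →
      k.1 ≤ (hi i).1 + 1 ∧ (hi i).1 ≤ k.1 + 1 → p (tgt (τ i) i) → p (src (τ i) i)) ∧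
    (k.1 = 0 → e = Dir.fwd → ¬p k) ∧ (k.1 + 1 = n → e = Dir.bwd → ¬p k)

/-- Whether the colimit around `k` of the module of type `τ` that is the field on `p` is
nonzero. -/
def IntAlive (τ : ZType n) (k : Fin n) (e : Dir) (p : Fin n → Prop) : Prop :=
  (∃ j : Nbr k, p j.1) ∧
    (∀ i : Fin (n - 1), k.1 ≤ (lo i).1 + 1 ∧ (lo i).1 ≤ k.1 + 1 →
      k.1 ≤ (hi i).1 + 1 ∧ (hi i).1 ≤ k.1 + 1 → p (src (τ i) i) → p (tgt (τ i) i)) ∧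
    (k.1 = 0 ∧ e = Dir.bwd ∨ k.1 + 1 = n ∧ e = Dir.fwd → ¬p k)

theorem introvert_type (V : ZModule F n) (k : Fin n) (e : Dir) (i : Fin (n - 1)) :
    (V.introvert k e).type i =
      if hi i = k then Dir.fwd else if lo i = k then Dir.bwd else V.type i := by
  simp only [type, introvert]
  split
  · rfl
  · split
    · rfl
    · exact Arrow.transport_dir ..

namespace Coords

variable {V : ZModule F n} {ι : Type} {P : ι → Fin n → Prop}

/-- The coordinates after the space at position `k` has been replaced. -/
def replaceφ (C : Coords V P) (k : Fin n) (L : FDSpace F) (φL : L →ₗ[F] (ι → F)) (j : Fin n) :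
    V.replaceSpace k L j →ₗ[F] (ι → F) :=
  if h : j = k then φL ∘ₗ (V.replaceSelf L h).toLinearMap
  else C.φ j ∘ₗ (V.replaceNe L h).toLinearMap

theorem replaceφ_self (C : Coords V P) {k : Fin n} {L : FDSpace F} {φL : L →ₗ[F] (ι → F)}
    {j : Fin n} (h : j = k) (x : V.replaceSpace k L j) :
    C.replaceφ k L φL j x = φL (V.replaceSelf L h x) := by
  rw [replaceφ, dif_pos h]
  rfl

theorem replaceφ_ne (C : Coords V P) {k : Fin n} {L : FDSpace F} {φL : L →ₗ[F] (ι → F)}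
    {j : Fin n} (h : j ≠ k) (x : V.replaceSpace k L j) :
    C.replaceφ k L φL j x = C.φ j (V.replaceNe L h x) := by
  rw [replaceφ, dif_neg h]
  rfl

/-- Coordinates after the space at position `k` has been replaced. -/
def replace (C : Coords V P) (k : Fin n) (L : FDSpace F)
    (A : ∀ i, Arrow (V.replaceSpace k L (lo i)) (V.replaceSpace k L (hi i)))
    (alive : ι → Prop) (φL : L →ₗ[F] (ι → F)) (φL_inj : Function.Injective φL)
    (φL_surj : ∀ c, (∀ a, ¬alive a → c a = 0) → ∃ y, φL y = c)
    (φL_supp : ∀ y a, ¬alive a → φL y a = 0)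
    (A_hi : ∀ i (h : hi i = k) (x : V.replaceSpace k L (lo i)) (y : V.replaceSpace k L (hi i)),
      (A i).Rel x y ↔ ∀ a, Function.update (P a) k (alive a) (tgt (A i).dir i) →
        C.φ (lo i) (V.replaceNe L (ne_of_hi_eq h) x) a = φL (V.replaceSelf L h y) a)
    (A_lo : ∀ i (h : lo i = k) (x : V.replaceSpace k L (lo i)) (y : V.replaceSpace k L (hi i)),
      (A i).Rel x y ↔ ∀ a, Function.update (P a) k (alive a) (tgt (A i).dir i) →
        φL (V.replaceSelf L h x) a = C.φ (hi i) (V.replaceNe L (ne_of_lo_eq h) y) a)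
    (A_ne : ∀ i (h : lo i ≠ k) (h' : hi i ≠ k),
      A i = (V.arrow i).transport (V.replaceNe L h).symm (V.replaceNe L h').symm) :
    Coords (⟨V.replaceSpace k L, A⟩ : ZModule F n)
      (fun a => Function.update (P a) k (alive a)) where
  φ := C.replaceφ k L φL
  inj j x y hxy := by
    by_cases h : j = k
    · rw [replaceφ_self C h, replaceφ_self C h] at hxy
      exact (V.replaceSelf L h).injective (φL_inj hxy)
    · rw [replaceφ_ne C h, replaceφ_ne C h] at hxy
      exact (V.replaceNe L h).injective (C.inj j hxy)
  surj j c hc := by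
    by_cases h : j = k
    · subst h
      obtain ⟨y, hy⟩ := φL_surj c fun a ha => hc a (by rwa [Function.update_self])
      exact ⟨(V.replaceSelf L rfl).symm y, by
        rw [replaceφ_self C rfl, LinearEquiv.apply_symm_apply, hy]⟩
    · obtain ⟨y, hy⟩ := C.surj j c fun a ha => hc a (by rwa [Function.update_of_ne h])
      exact ⟨(V.replaceNe L h).symm y, by
        rw [replaceφ_ne C h, LinearEquiv.apply_symm_apply, hy]⟩
  supp j x a ha := by
    by_cases h : j = k
    · subst h
      rw [Function.update_self] at ha
      rw [replaceφ_self C rfl]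
      exact φL_supp _ _ ha
    · rw [Function.update_of_ne h] at ha
      rw [replaceφ_ne C h]
      exact C.supp _ _ _ ha
  rel i x y := by
    by_cases h : hi i = k
    · rw [replaceφ_self C h, replaceφ_ne C (ne_of_hi_eq h)]
      exact A_hi i h x y
    · by_cases h' : lo i = k
      · rw [replaceφ_self C h', replaceφ_ne C h]
        exact A_lo i h' x y
      · rw [replaceφ_ne C h', replaceφ_ne C h]
        have key : ∀ B : Arrow (V.replaceSpace k L (lo i)) (V.replaceSpace k L (hi i)),
            B = (V.arrow i).transport (V.replaceNe L h').symm (V.replaceNe L h).symm →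
            (B.Rel x y ↔ ∀ a, Function.update (P a) k (alive a) (tgt B.dir i) →
              C.φ (lo i) (V.replaceNe L h' x) a = C.φ (hi i) (V.replaceNe L h y) a) := by
          rintro _ rfl
          rw [Arrow.transport_rel, C.rel, LinearEquiv.symm_symm, LinearEquiv.symm_symm]
          refine forall_congr' fun a => ?_
          rw [Arrow.transport_dir, Function.update_of_ne]
          · rfl
          · cases (V.arrow i).dir
            · exact h
            · exact h'
        exact key _ (A_ne i h' h)

open Classical in
/-- The coordinates on a limit. -/
def limφ (C : Coords V P) (k : Fin n) (e : Dir) : V.limSpace k e →ₗ[F] (ι → F) :=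
  LinearMap.pi fun a => if h : ∃ j : Nbr k, P a j.1 then
    LinearMap.proj a ∘ₗ C.φ h.choose.1 ∘ₗ LinearMap.proj h.choose ∘ₗ (V.limSpace k e).subtype
    else 0

/-- A compatible family has a constant coordinate along a bar, and the bar meets the neighbourhood
in a convex set. So the neighbour chosen in `limφ` is immaterial. -/
theorem limφ_apply (C : Coords V P)
    (hP : ∀ a (i j l : Fin n), i ≤ j → j ≤ l → P a i → P a l → P a j) {k : Fin n} {e : Dir}
    (y : V.limSpace k e) {a : ι} (j : Nbr k) (hj : P a j.1) :
    C.limφ k e y a = C.φ j.1 (y.1 j) a := by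
  have h : ∃ j : Nbr k, P a j.1 := ⟨j, hj⟩
  simp only [limφ, LinearMap.pi_apply, dif_pos h]
  refine eq_of_mem_nbr (hP a) (fun j => C.φ j.1 (y.1 j) a) (fun i h₁ h₂ hl hh => ?_) _ _
    h.choose_spec hj
  refine (C.rel i _ _).1 (y.2.1 i h₁ h₂) a ?_
  cases V.type i
  · exact hh
  · exact hl

theorem limφ_eq_zero (C : Coords V P) {k : Fin n} {e : Dir}
    (y : V.limSpace k e) {a : ι} (h : ¬∃ j : Nbr k, P a j.1) :
    C.limφ k e y a = 0 := by
  simp only [limφ, LinearMap.pi_apply, dif_neg h]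
  rfl

/-- Coordinates after an extroversion. -/
def extrovert (C : Coords V P)
    (hP : ∀ a (i j l : Fin n), i ≤ j → j ≤ l → P a i → P a l → P a j) (k : Fin n) (e : Dir) :
    Coords (V.extrovert k e)
      (fun a => Function.update (P a) k (ExtAlive V.type k e (P a))) := by
  -- If an arrow enters the bar from outside, the coordinate is `0` at its target and therefore,
  -- being constant, everywhere near `k`; an added zero space mapping into an end of the module has
  -- the same effect.
  have supp : ∀ y a, ¬ExtAlive V.type k e (P a) → C.limφ k e y a = 0 := by
    intro y a ha
    by_contra hne
    refine ha ⟨?_, fun i h₁ h₂ ht => ?_, fun h h' hk => hne ?_, fun h h' hk => hne ?_⟩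
    · by_contra h
      exact hne (C.limφ_eq_zero y h)
    · by_contra hs
      refine hne ?_
      have hr := (C.rel i _ _).1 (y.2.1 i h₁ h₂) a ht
      cases hd : V.type i with
      | fwd =>
        rw [hd] at ht hs
        rw [C.limφ_apply hP y ⟨hi i, h₂⟩ ht, ← hr]
        exact C.supp _ _ _ hs
      | bwd =>
        rw [hd] at ht hs
        rw [C.limφ_apply hP y ⟨lo i, h₁⟩ ht, hr]
        exact C.supp _ _ _ hs
    · rw [C.limφ_apply hP y (Nbr.self k) hk, y.2.2.1 h h', map_zero]
      rfl
    · rw [C.limφ_apply hP y (Nbr.self k) hk, y.2.2.2 h h', map_zero]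
      rfl
  refine C.replace k ⟨V.limSpace k e⟩ _ _ (C.limφ k e) ?_ ?_ supp ?_ ?_ ?_
  · rw [injective_iff_map_eq_zero]
    intro y hy
    refine Subtype.ext (funext fun j => C.inj j.1 (funext fun a => ?_))
    by_cases h : P a j.1
    · rw [← C.limφ_apply hP y j h, hy]
      simp
    · rw [C.supp _ _ _ h, C.supp _ _ _ h]
  · intro c hc
    have hvec : ∀ j a, C.φ j (C.vec j c) a ≠ 0 → P a j ∧ ExtAlive V.type k e (P a) := by
      intro j a h
      rw [C.φ_vec] at h
      split at h
      · next hj => exact ⟨hj, by_contra fun h' => h (hc a h')⟩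
      · exact absurd rfl h
    have hself : (∀ a, P a k → ¬ExtAlive V.type k e (P a)) → C.vec k c = 0 := by
      intro h
      refine C.inj k (funext fun a => ?_)
      rw [map_zero]
      by_contra h'
      have := hvec k a h'
      exact h a this.1 this.2
    -- The section takes the coordinates `c` at every neighbour, cut off by the bars. Since `c` is
    -- supported on alive bars, no arrow enters a bar with nonzero entry from outside.
    refine ⟨⟨fun j => C.vec j.1 c, fun i h₁ h₂ => (C.rel i _ _).2 fun a ha => ?_,
      fun h h' => hself fun a hk ha => ha.2.2.1 h h' hk,
      fun h h' => hself fun a hk ha => ha.2.2.2 h h' hk⟩, funext fun a => ?_⟩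
    · by_cases hal : ExtAlive V.type k e (P a)
      · have hs := hal.2.1 i h₁ h₂ ha
        rw [C.φ_vec, C.φ_vec]
        cases hd : V.type i with
        | fwd =>
          rw [hd] at ha hs
          exact (if_pos hs).trans (if_pos ha).symm
        | bwd =>
          rw [hd] at ha hs
          exact (if_pos ha).trans (if_pos hs).symm
      · simp [C.φ_vec, hc a hal]
    · by_cases h : ∃ j : Nbr k, P a j.1
      · obtain ⟨j, hj⟩ := h
        rw [C.limφ_apply hP _ j hj, C.φ_vec, if_pos hj]
      · rw [C.limφ_eq_zero _ h, hc a fun h' => h h'.1]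
  · intro i h x y
    simp only [dif_pos h, Arrow.Rel, Arrow.dir, tgt, LinearMap.comp_apply, LinearEquiv.coe_coe,
      LinearEquiv.symm_apply_eq, Function.update_of_ne (ne_of_hi_eq h)]
    rw [← (C.inj _).eq_iff, funext_iff]
    refine forall_congr' fun a => ?_
    by_cases ha : P a (lo i)
    · rw [C.limφ_apply hP _ ⟨lo i, mem_nbr_of_hi_eq h⟩ ha]
      exact ⟨fun h _ => h.symm, fun h => (h ha).symm⟩
    · exact ⟨fun _ h => absurd h ha, fun _ => (C.supp _ _ _ ha).trans (C.supp _ _ _ ha).symm⟩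
  · intro i h x y
    simp only [dif_neg (ne_of_lo_eq h), dif_pos h, Arrow.Rel, Arrow.dir, tgt,
      LinearMap.comp_apply, LinearEquiv.coe_coe,
      LinearEquiv.symm_apply_eq, Function.update_of_ne (ne_of_lo_eq h)]
    rw [← (C.inj _).eq_iff, funext_iff]
    refine forall_congr' fun a => ?_
    by_cases ha : P a (hi i)
    · rw [C.limφ_apply hP _ ⟨hi i, mem_nbr_of_lo_eq h⟩ ha]
      exact ⟨fun h _ => h, fun h => h ha⟩
    · exact ⟨fun _ h => absurd h ha, fun _ => (C.supp _ _ _ ha).trans (C.supp _ _ _ ha).symm⟩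
  · intro i h h'
    simp only [dif_neg h, dif_neg h']

open Classical in
/-- The coordinates on the product of the spaces around `k` that induce coordinates on the
colimit. -/
def sumφ (C : Coords V P) (k : Fin n) (e : Dir) : (∀ j : Nbr k, V.space j.1) →ₗ[F] (ι → F) :=
  LinearMap.pi fun a => if IntAlive V.type k e (P a) then
    ∑ j : Nbr k, LinearMap.proj a ∘ₗ C.φ j.1 ∘ₗ LinearMap.proj j else 0

theorem sumφ_of_alive (C : Coords V P) {k : Fin n} {e : Dir} (x : ∀ j : Nbr k, V.space j.1)
    {a : ι} (ha : IntAlive V.type k e (P a)) :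
    C.sumφ k e x a = ∑ j : Nbr k, C.φ j.1 (x j) a := by
  simp only [sumφ, LinearMap.pi_apply, if_pos ha, LinearMap.sum_apply]
  rfl

theorem sumφ_of_not_alive (C : Coords V P) {k : Fin n} {e : Dir}
    (x : ∀ j : Nbr k, V.space j.1) {a : ι} (ha : ¬IntAlive V.type k e (P a)) :
    C.sumφ k e x a = 0 := by
  simp only [sumφ, LinearMap.pi_apply, if_neg ha]
  rfl

theorem sumφ_single (C : Coords V P) {k : Fin n} {e : Dir} (j : Nbr k) (x : V.space j.1)
    {a : ι} (ha : IntAlive V.type k e (P a)) :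
    C.sumφ k e (Pi.single (M := fun j : Nbr k => V.space j.1) j x) a = C.φ j.1 x a := by
  rw [C.sumφ_of_alive _ ha, Finset.sum_eq_single j]
  · rw [Pi.single_eq_same]
  · intro j' _ hj'
    rw [Pi.single_eq_of_ne hj', map_zero]
    rfl
  · exact fun h => absurd (Finset.mem_univ j) h

/-- No arrow leaves an alive bar. So related elements either have equal coordinates, when the target
lies in the bar, or both have coordinate zero; the sum of the coordinates over the neighbours is
thus invariant under the identifications. -/
theorem colimRel_le_ker (C : Coords V P) (k : Fin n) (e : Dir) :
    V.colimRel k e ≤ LinearMap.ker (C.sumφ k e) := by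
  refine Submodule.span_le.2 ?_
  rintro _ (⟨i, h₁, h₂, x, y, hxy, rfl⟩ | ⟨h, v, rfl⟩)
  · refine funext fun a => ?_
    by_cases ha : IntAlive V.type k e (P a)
    · rw [map_sub, Pi.sub_apply, C.sumφ_single ⟨lo i, h₁⟩ x ha, C.sumφ_single ⟨hi i, h₂⟩ y ha]
      refine sub_eq_zero.2 ?_
      by_cases ht : P a (tgt (V.type i) i)
      · exact (C.rel i x y).1 hxy a ht
      · have hs := mt (ha.2.1 i h₁ h₂) ht
        cases hd : V.type i with
        | fwd =>
          rw [hd] at ht hs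
          exact (C.supp _ _ _ hs).trans (C.supp _ _ _ ht).symm
        | bwd =>
          rw [hd] at ht hs
          exact (C.supp _ _ _ ht).trans (C.supp _ _ _ hs).symm
    · exact C.sumφ_of_not_alive _ ha
  · refine funext fun a => ?_
    by_cases ha : IntAlive V.type k e (P a)
    · exact (C.sumφ_single (Nbr.self k) v ha).trans (C.supp _ _ _ (ha.2.2 h))
    · exact C.sumφ_of_not_alive _ ha

open Classical in
/-- The class in the colimit of the `a`-th basis vector at the position `j`, times `t`. -/
def colimVec (C : Coords V P) (k : Fin n) (e : Dir) (a : ι) (j : Nbr k) :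
    F →ₗ[F] (∀ j : Nbr k, V.space j.1) ⧸ V.colimRel k e :=
  (V.colimRel k e).mkQ ∘ₗ LinearMap.single F (fun j : Nbr k => V.space j.1) j ∘ₗ C.vec j.1 ∘ₗ
    LinearMap.single F (fun _ : ι => F) a

theorem colimVec_eq_zero (C : Coords V P) {k : Fin n} {e : Dir} {a : ι} {j : Nbr k}
    (h : ¬P a j.1) : C.colimVec k e a j = 0 := by
  classical
  refine LinearMap.ext fun t => ?_
  have : C.vec j.1 (Pi.single a t) = 0 := by
    refine C.inj j.1 (funext fun b => ?_)
    rw [C.φ_vec, map_zero]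
    by_cases hb : b = a
    · subst hb
      exact if_neg h
    · simp [hb]
  change (V.colimRel k e).mkQ
    (Pi.single (M := fun j : Nbr k => V.space j.1) j (C.vec j.1 (Pi.single a t))) = 0
  rw [this, Pi.single_zero, map_zero]

theorem colimVec_lo_eq_hi (C : Coords V P) {k : Fin n} {e : Dir} {a : ι} {i : Fin (n - 1)}
    (h₁ : k.1 ≤ (lo i).1 + 1 ∧ (lo i).1 ≤ k.1 + 1) (h₂ : k.1 ≤ (hi i).1 + 1 ∧ (hi i).1 ≤ k.1 + 1)
    (h : P a (tgt (V.type i) i) → P a (src (V.type i) i)) :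
    C.colimVec k e a ⟨lo i, h₁⟩ = C.colimVec k e a ⟨hi i, h₂⟩ := by
  classical
  refine LinearMap.ext fun t => ?_
  refine (Submodule.Quotient.eq _).2 (Submodule.subset_span (Or.inl ⟨i, h₁, h₂, _, _, ?_, rfl⟩))
  refine (C.rel i _ _).2 fun b hb => ?_
  change C.φ (lo i) (C.vec (lo i) (Pi.single a t)) b =
    C.φ (hi i) (C.vec (hi i) (Pi.single a t)) b
  rw [C.φ_vec, C.φ_vec]
  by_cases hba : b = a
  · subst hba
    have hs := h hb
    cases hd : V.type i with
    | fwd =>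
      rw [hd] at hb hs
      exact (if_pos hs).trans (if_pos hb).symm
    | bwd =>
      rw [hd] at hb hs
      exact (if_pos hb).trans (if_pos hs).symm
  · simp [hba]

theorem colimVec_eq (C : Coords V P)
    (hP : ∀ a (i j l : Fin n), i ≤ j → j ≤ l → P a i → P a l → P a j) {k : Fin n} {e : Dir}
    {a : ι} (j j' : Nbr k) (hj : P a j.1) (hj' : P a j'.1) :
    C.colimVec k e a j = C.colimVec k e a j' := by
  refine eq_of_mem_nbr (hP a) _ (fun i h₁ h₂ hl hh => C.colimVec_lo_eq_hi h₁ h₂ fun _ => ?_)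
    j j' hj hj'
  cases V.type i
  · exact hl
  · exact hh

/-- The basis vectors of one bar at all its positions near `k` have the same class. If an arrow
leaves the bar, or the end is identified with an added zero, one of these classes is zero, hence all
are. -/
theorem colimVec_eq_zero_of_not_alive (C : Coords V P)
    (hP : ∀ a (i j l : Fin n), i ≤ j → j ≤ l → P a i → P a l → P a j) {k : Fin n} {e : Dir}
    {a : ι} (ha : ¬IntAlive V.type k e (P a)) (j : Nbr k) : C.colimVec k e a j = 0 := by
  by_cases hj : P a j.1
  swap
  · exact C.colimVec_eq_zero hj
  by_contra hne
  have hne' : ∀ j' : Nbr k, P a j'.1 → C.colimVec k e a j' ≠ 0 := fun j' hj' h =>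
    hne ((C.colimVec_eq hP j j' hj hj').trans h)
  refine ha ⟨⟨j, hj⟩, fun i h₁ h₂ hs => ?_, fun h hk => ?_⟩
  · by_contra ht
    have heq := C.colimVec_lo_eq_hi (e := e) h₁ h₂ fun h => absurd h ht
    cases hd : V.type i with
    | fwd =>
      rw [hd] at ht hs
      exact hne' ⟨lo i, h₁⟩ hs (heq.trans (C.colimVec_eq_zero ht))
    | bwd =>
      rw [hd] at ht hs
      exact hne' ⟨hi i, h₂⟩ hs (heq.symm.trans (C.colimVec_eq_zero ht))
  · refine hne' (Nbr.self k) hk (LinearMap.ext fun t => ?_)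
    exact (Submodule.Quotient.mk_eq_zero _).2 (Submodule.subset_span (Or.inr ⟨h, _, rfl⟩))

theorem mkQ_eq_sum (C : Coords V P) [Fintype ι] (k : Fin n) (e : Dir)
    (x : ∀ j : Nbr k, V.space j.1) :
    (V.colimRel k e).mkQ x = ∑ a, ∑ j, C.colimVec k e a j (C.φ j.1 (x j) a) := by
  classical
  rw [Finset.sum_comm]
  have h : ∀ j : Nbr k, ∑ a, C.colimVec k e a j (C.φ j.1 (x j) a) =
      (V.colimRel k e).mkQ (LinearMap.single F (fun j : Nbr k => V.space j.1) j (x j)) := by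
    intro j
    conv_rhs => rw [← C.vec_φ j.1 (x j), ← Finset.univ_sum_single (C.φ j.1 (x j))]
    simp only [map_sum]
    refine Finset.sum_congr rfl fun a _ => ?_
    simp only [colimVec, LinearMap.comp_apply, LinearMap.coe_single]
  rw [Finset.sum_congr rfl fun j _ => h j, ← map_sum]
  congr 1
  exact (Finset.univ_sum_single x).symm

/-- The class of `x` is expanded into classes of basis vectors. A dead bar contributes zero, and the
terms of an alive bar combine to one class with coefficient `C.sumφ k e x a`, which vanishes by
assumption. -/
theorem ker_le_colimRel (C : Coords V P) [Finite ι]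
    (hP : ∀ a (i j l : Fin n), i ≤ j → j ≤ l → P a i → P a l → P a j) (k : Fin n) (e : Dir) :
    LinearMap.ker (C.sumφ k e) ≤ V.colimRel k e := by
  have := Fintype.ofFinite ι
  intro x hx
  rw [← Submodule.ker_mkQ (V.colimRel k e), LinearMap.mem_ker, C.mkQ_eq_sum]
  refine Finset.sum_eq_zero fun a _ => ?_
  by_cases ha : IntAlive V.type k e (P a)
  · obtain ⟨j₀, h0⟩ := ha.1
    have : ∀ j : Nbr k, C.colimVec k e a j (C.φ j.1 (x j) a) =
        C.colimVec k e a j₀ (C.φ j.1 (x j) a) := by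
      intro j
      by_cases hj : P a j.1
      · rw [C.colimVec_eq hP j j₀ hj h0]
      · rw [C.supp _ _ _ hj, map_zero, map_zero]
    rw [Finset.sum_congr rfl fun j _ => this j, ← map_sum, ← C.sumφ_of_alive x ha,
      LinearMap.mem_ker.1 hx]
    exact map_zero _
  · exact Finset.sum_eq_zero fun j _ => by rw [C.colimVec_eq_zero_of_not_alive hP ha]; rfl

/-- The coordinates on a colimit. -/
def colimφ (C : Coords V P) (k : Fin n) (e : Dir) :
    ((∀ j : Nbr k, V.space j.1) ⧸ V.colimRel k e) →ₗ[F] (ι → F) :=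
  (V.colimRel k e).liftQ (C.sumφ k e) (C.colimRel_le_ker k e)

/-- Coordinates after an introversion. -/
def introvert (C : Coords V P) [Finite ι]
    (hP : ∀ a (i j l : Fin n), i ≤ j → j ≤ l → P a i → P a l → P a j) (k : Fin n) (e : Dir) :
    Coords (V.introvert k e)
      (fun a => Function.update (P a) k (IntAlive V.type k e (P a))) := by
  have supp : ∀ y a, ¬IntAlive V.type k e (P a) → C.colimφ k e y a = 0 := by
    intro y a ha
    obtain ⟨x, rfl⟩ := Submodule.mkQ_surjective _ y
    exact C.sumφ_of_not_alive x ha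
  have inj : Function.Injective (C.colimφ k e) := by
    rw [← LinearMap.ker_eq_bot]
    exact Submodule.ker_liftQ_eq_bot _ _ _ (C.ker_le_colimRel hP k e)
  refine C.replace k ⟨(∀ j : Nbr k, V.space j.1) ⧸ V.colimRel k e⟩ _ _ (C.colimφ k e) inj ?_
    supp ?_ ?_ ?_
  · intro c hc
    classical
    have hch : ∀ a, ∃ j₀ : Nbr k, IntAlive V.type k e (P a) → P a j₀.1 := by
      intro a
      by_cases ha : IntAlive V.type k e (P a)
      · obtain ⟨j, hj⟩ := ha.1
        exact ⟨j, fun _ => hj⟩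
      · exact ⟨Nbr.self k, fun h => absurd h ha⟩
    choose j₀ hj₀ using hch
    -- Each coordinate is placed at a single neighbour in its bar, so the sum over neighbours counts
    -- it once.
    refine ⟨(V.colimRel k e).mkQ fun j => C.vec j.1 fun a => if j = j₀ a then c a else 0,
      funext fun a => ?_⟩
    by_cases ha : IntAlive V.type k e (P a)
    · refine (C.sumφ_of_alive _ ha).trans ?_
      rw [Finset.sum_eq_single (j₀ a)]
      · rw [C.φ_vec, if_pos (hj₀ a ha), if_pos rfl]
      · intro j _ hj
        rw [C.φ_vec, if_neg hj, ite_self]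
      · exact fun h => absurd (Finset.mem_univ _) h
    · exact (C.sumφ_of_not_alive _ ha).trans (hc a ha).symm
  · intro i h x y
    have hQ : ∀ a, Function.update (P a) k (IntAlive V.type k e (P a)) (hi i) =
        IntAlive V.type k e (P a) := fun a => by rw [h, Function.update_self]
    simp only [dif_pos h, Arrow.Rel, Arrow.dir, tgt, LinearMap.comp_apply, LinearEquiv.coe_coe,
      LinearEquiv.symm_apply_eq, hQ]
    rw [← inj.eq_iff, funext_iff]
    refine forall_congr' fun a => ?_
    by_cases ha : IntAlive V.type k e (P a)
    · have := C.sumφ_single (e := e) ⟨lo i, mem_nbr_of_hi_eq h⟩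
        (V.replaceNe ⟨(∀ j : Nbr k, V.space j.1) ⧸ V.colimRel k e⟩ (ne_of_hi_eq h) x) ha
      exact ⟨fun h _ => this.symm.trans h, fun h => this.trans (h ha)⟩
    · exact ⟨fun _ h => absurd h ha, fun _ => (supp _ _ ha).trans (supp _ _ ha).symm⟩
  · intro i h x y
    have hQ : ∀ a, Function.update (P a) k (IntAlive V.type k e (P a)) (lo i) =
        IntAlive V.type k e (P a) := fun a => by rw [h, Function.update_self]
    simp only [dif_neg (ne_of_lo_eq h), dif_pos h, Arrow.Rel, Arrow.dir, tgt,
      LinearMap.comp_apply, LinearEquiv.coe_coe, LinearEquiv.symm_apply_eq, hQ]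
    rw [← inj.eq_iff, funext_iff]
    refine forall_congr' fun a => ?_
    by_cases ha : IntAlive V.type k e (P a)
    · have := C.sumφ_single (e := e) ⟨hi i, mem_nbr_of_lo_eq h⟩
        (V.replaceNe ⟨(∀ j : Nbr k, V.space j.1) ⧸ V.colimRel k e⟩ (ne_of_lo_eq h) y) ha
      exact ⟨fun h _ => h.symm.trans this, fun h => this.trans (h ha).symm⟩
    · exact ⟨fun _ h => absurd h ha, fun _ => (supp _ _ ha).trans (supp _ _ ha).symm⟩
  · intro i h h'
    simp only [dif_neg h, dif_neg h']

end Coords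

end ZModule

/-! ### Effect of reflections on bars -/

/-- The `ℓ¹`-distance of two pairs of natural numbers. -/
def natDist (x y : ℕ × ℕ) : ℕ := (x.1 - y.1) + (y.1 - x.1) + ((x.2 - y.2) + (y.2 - x.2))

namespace Reflection

variable {n : ℕ}

/-- The position at which a reflection acts. -/
def pos : Reflection n → Fin n
  | ext k _ => k
  | int k _ => k

/-- Whether the module of type `τ` that is the field on `p` is nonzero at the position of the
reflection, after the reflection. -/
def Alive (τ : ZType n) (p : Fin n → Prop) : Reflection n → Prop
  | ext k e => ZModule.ExtAlive τ k e p
  | int k e => ZModule.IntAlive τ k e p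

theorem Alive.exists_nbr {τ : ZType n} {p : Fin n → Prop} {R : Reflection n}
    (h : R.Alive τ p) : ∃ j : ZModule.Nbr R.pos, p j.1 := by
  cases R <;> exact h.1

/-- All neighbours exist and lie in the bar, so no arrow near `k` enters or leaves it and no added
zero space is involved. -/
theorem alive_of_interior {τ : ZType n} {x : ℕ × ℕ} (hx : 1 ≤ x.1 ∧ x.2 ≤ n) {R : Reflection n}
    (h₁ : x.1 < R.pos.1 + 1) (h₂ : R.pos.1 + 1 < x.2) : R.Alive τ (ZModule.InBar x) := by
  have key : ∀ k : Fin n, x.1 < k.1 + 1 → k.1 + 1 < x.2 → ∀ j : Fin n,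
      k.1 ≤ j.1 + 1 ∧ j.1 ≤ k.1 + 1 → ZModule.InBar x j := by
    intro k h₁ h₂ j hj
    simp only [ZModule.InBar]
    omega
  have hsrc : ∀ (d : Dir) (i : Fin (n - 1)) (p : Fin n → Prop), p (lo i) → p (hi i) →
      p (src d i) ∧ p (tgt d i) := by
    rintro (_ | _) i p hl hh
    · exact ⟨hl, hh⟩
    · exact ⟨hh, hl⟩
  cases R with
  | ext k e =>
    have hk := key k h₁ h₂
    simp only [pos] at h₁ h₂
    exact ⟨⟨ZModule.Nbr.self k, hk _ (ZModule.Nbr.self k).2⟩,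
      fun i hl hh _ => (hsrc _ i _ (hk _ hl) (hk _ hh)).1, fun h => by omega, fun h => by omega⟩
  | int k e =>
    have hk := key k h₁ h₂
    simp only [pos] at h₁ h₂
    exact ⟨⟨ZModule.Nbr.self k, hk _ (ZModule.Nbr.self k).2⟩,
      fun i hl hh _ => (hsrc _ i _ (hk _ hl) (hk _ hh)).2, fun h => by omega⟩

/-- A reflection moves an endpoint of a nonsimple bar by at most one. -/
theorem exists_bar (R : Reflection n) (τ : ZType n) {x : ℕ × ℕ}
    (hx : 1 ≤ x.1 ∧ x.1 < x.2 ∧ x.2 ≤ n) :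
    ∃ x' : ℕ × ℕ, (1 ≤ x'.1 ∧ x'.1 ≤ x'.2 ∧ x'.2 ≤ n) ∧ natDist x x' ≤ 1 ∧
      Function.update (ZModule.InBar x) R.pos (R.Alive τ (ZModule.InBar x)) =
        ZModule.InBar x' := by
  have hin := alive_of_interior (τ := τ) ⟨hx.1, hx.2.2⟩ (R := R)
  -- A bar that misses all neighbours of the reflected position stays zero there, so a bar can grow
  -- only by one index.
  have hout : R.Alive τ (ZModule.InBar x) →
      x.1 ≤ R.pos.1 + 2 ∧ R.pos.1 ≤ x.2 := by
    intro h
    obtain ⟨⟨j, hj⟩, h1, h2⟩ := h.exists_nbr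
    simp only at h1 h2
    omega
  have upd : ∀ x' : ℕ × ℕ, (∀ j : Fin n, j ≠ R.pos → (ZModule.InBar x j ↔ ZModule.InBar x' j)) →
      (R.Alive τ (ZModule.InBar x) ↔ ZModule.InBar x' R.pos) →
      Function.update (ZModule.InBar x) R.pos (R.Alive τ (ZModule.InBar x)) =
        ZModule.InBar x' := by
    intro x' h₁ h₂
    funext j
    by_cases hj : j = R.pos
    · rw [hj, Function.update_self]
      exact propext h₂
    · rw [Function.update_of_ne hj]
      exact propext (h₁ j hj)
  generalize hA : R.Alive τ (ZModule.InBar x) = A at *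
  generalize R.pos = k at *
  obtain ⟨b, d⟩ := x
  simp only [natDist, ZModule.InBar, ne_eq, Fin.ext_iff] at *
  have hkn := k.2
  by_cases h : A
  · have h' := hout h
    simp only [h, true_iff] at upd ⊢
    -- The position `k` is the index `k + 1`. The cases are growth at the left end, growth at the
    -- right end, and no change because the index already lies in the bar.
    by_cases h₁ : k.1 + 2 = b
    · exact ⟨(b - 1, d), by simp only; omega, by simp only; omega,
        upd _ (fun j hj => by simp only; omega) (by simp only; omega)⟩
    · by_cases h₂ : k.1 = d
      · exact ⟨(b, d + 1), by simp only; omega, by simp only; omega,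
          upd _ (fun j hj => by simp only; omega) (by simp only; omega)⟩
      · exact ⟨(b, d), by simp only; omega, by simp only; omega,
          upd _ (fun j hj => by simp only) (by simp only; omega)⟩
  · have h' : ¬(b < k.1 + 1 ∧ k.1 + 1 < d) := fun h' => h (hin h'.1 h'.2)
    simp only [h, false_iff] at upd ⊢
    -- A dead bar loses an end or is unchanged. Because `b < d`, removing an end leaves a nonempty
    -- interval.
    by_cases h₁ : k.1 + 1 = b
    · exact ⟨(b + 1, d), by simp only; omega, by simp only; omega,
        upd _ (fun j hj => by simp only; omega) (by simp only; omega)⟩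
    · by_cases h₂ : k.1 + 1 = d
      · exact ⟨(b, d - 1), by simp only; omega, by simp only; omega,
          upd _ (fun j hj => by simp only; omega) (by simp only; omega)⟩
      · exact ⟨(b, d), by simp only; omega, by simp only; omega,
          upd _ (fun j hj => by simp only) (by simp only; omega)⟩

end Reflection

namespace ZModule

variable {F : Type u} [Field F] {n : ℕ}

/-- Coordinates after a reflection. -/
def Coords.reflect {V : ZModule F n} {ι : Type} {P : ι → Fin n → Prop} [Finite ι]
    (C : Coords V P) (hP : ∀ a (i j l : Fin n), i ≤ j → j ≤ l → P a i → P a l → P a j)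
    (R : Reflection n) : Coords (V.reflect R)
      (fun a => Function.update (P a) R.pos (R.Alive V.type (P a))) :=
  match R with
  | Reflection.ext k e => C.extrovert hP k e
  | Reflection.int k e => C.introvert hP k e

theorem intervalSum_type (τ : ZType n) (D : Multiset (ℕ × ℕ)) :
    (intervalSum F τ D).type = τ :=
  directSum_type ..

theorem sanitize_type (V : ZModule F n) : V.sanitize.type = V.type :=
  intervalSum_type ..

theorem map_subtype_univ {ι α : Type*} [Fintype ι] (f : ι → α) (p : α → Prop)
    [DecidablePred p] :
    (Finset.univ : Finset {a // p (f a)}).val.map (fun a => f a.1) =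
      (Finset.univ.val.map f).filter p := by
  rw [Multiset.filter_map]
  refine (Multiset.map_map f Subtype.val _).symm.trans (congrArg _ ?_)
  change _ = (Finset.univ.filter (p ∘ f)).val
  rw [← Finset.subtype_map]
  simp
  rfl

theorem Coords.sanitize {V : ZModule F n} {ι : Type} [Fintype ι] {bar : ι → ℕ × ℕ}
    (C : Coords V (fun a => InBar (bar a)))
    (hb : ∀ a, 1 ≤ (bar a).1 ∧ (bar a).1 ≤ (bar a).2 ∧ (bar a).2 ≤ n) :
    Nonempty (Coords V.sanitize
      (fun a : {a // (bar a).1 ≠ (bar a).2} => InBar (bar a.1))) := by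
  classical
  have hD := (C.isDecomposition hb).dgm_eq
  obtain ⟨e, he⟩ := exists_equiv_toType (fun a : {a // (bar a).1 ≠ (bar a).2} => bar a.1)
    (D := V.dgm.filter fun x => x.1 ≠ x.2) (by
      rw [hD]
      exact map_subtype_univ bar fun x => x.1 ≠ x.2)
  refine ⟨Coords.reindex (Coords.ofIntervalSum V.type (V.dgm.filter fun x => x.1 ≠ x.2)) e.symm
    fun a j => ?_⟩
  rw [← he, Equiv.apply_symm_apply]

/-- The map `f` sends a surviving bar to the bar it came from. A lost bar became simple by a move of
size at most one, so it had `d - b ≤ 1`. -/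
theorem Coords.reflect_sanitize {V : ZModule F n} {ι : Type} [Fintype ι] {bar : ι → ℕ × ℕ}
    (C : Coords V (fun a => InBar (bar a)))
    (hb : ∀ a, 1 ≤ (bar a).1 ∧ (bar a).1 < (bar a).2 ∧ (bar a).2 ≤ n) (R : Reflection n) :
    ∃ (κ : Type) (_ : Fintype κ) (f : κ → ι) (bar' : κ → ℕ × ℕ), Function.Injective f ∧
      (∀ c, 1 ≤ (bar' c).1 ∧ (bar' c).1 < (bar' c).2 ∧ (bar' c).2 ≤ n) ∧
      (∀ c, natDist (bar (f c)) (bar' c) ≤ 1) ∧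
      (∀ a ∉ Set.range f, (bar a).2 - (bar a).1 ≤ 1) ∧
      (∀ c, InBar (bar' c) = Function.update (InBar (bar (f c))) R.pos
        (R.Alive V.type (InBar (bar (f c))))) ∧
      Nonempty (Coords (V.reflect R).sanitize (fun c => InBar (bar' c))) := by
  classical
  choose bar' h₁ h₂ h₃ using fun a => R.exists_bar V.type (hb a)
  have C' := C.reflect (fun a => InBar.convex) R
  simp only [h₃] at C'
  refine ⟨{a // (bar' a).1 ≠ (bar' a).2}, inferInstance, Subtype.val, fun a => bar' a.1,
    Subtype.val_injective, fun c => ⟨(h₁ c.1).1, lt_of_le_of_ne (h₁ c.1).2.1 c.2, (h₁ c.1).2.2⟩,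
    fun c => h₂ c.1, fun a ha => ?_, fun c => (h₃ c.1).symm,
    C'.sanitize h₁⟩
  · have hs : (bar' a).1 = (bar' a).2 := by
      by_contra h
      exact ha ⟨⟨a, h⟩, rfl⟩
    have := h₂ a
    simp only [natDist] at this
    omega

/-- The bars of a module after a sequence of reflections, compared to the original bars. -/
theorem Coords.reflectSeq {V : ZModule F n} {ι : Type} [Fintype ι] {bar : ι → ℕ × ℕ}
    (C : Coords V (fun a => InBar (bar a)))
    (hb : ∀ a, 1 ≤ (bar a).1 ∧ (bar a).1 ≤ (bar a).2 ∧ (bar a).2 ≤ n) (l : List (Reflection n)) :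
    ∃ (κ : Type) (_ : Fintype κ) (f : κ → ι) (bar' : κ → ℕ × ℕ), Function.Injective f ∧
      (∀ c, 1 ≤ (bar' c).1 ∧ (bar' c).1 < (bar' c).2 ∧ (bar' c).2 ≤ n) ∧
      (∀ c, natDist (bar (f c)) (bar' c) ≤ l.length) ∧
      (∀ a ∉ Set.range f, (bar a).2 - (bar a).1 ≤ l.length) ∧
      Nonempty (Coords (V.reflectSeq l) (fun c => InBar (bar' c))) := by
  classical
  induction l with
  | nil =>
    refine ⟨{a // (bar a).1 ≠ (bar a).2}, inferInstance, Subtype.val, fun a => bar a.1,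
      Subtype.val_injective,
      fun c => ⟨(hb c.1).1, lt_of_le_of_ne (hb c.1).2.1 c.2, (hb c.1).2.2⟩, fun c => ?_,
      fun a ha => ?_, C.sanitize hb⟩
    · simp [natDist]
    · have hs : (bar a).1 = (bar a).2 := by
        by_contra h
        exact ha ⟨⟨a, h⟩, rfl⟩
      omega
  | cons R l ih =>
    obtain ⟨κ, _, f, bar', hf, h₁, h₂, h₃, ⟨C'⟩⟩ := ih
    obtain ⟨κ', _, f', bar'', hf', h₁', h₂', h₃', -, C''⟩ := C'.reflect_sanitize h₁ R
    refine ⟨κ', inferInstance, f ∘ f', bar'', hf.comp hf', h₁', fun c => ?_, fun a ha => ?_, C''⟩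
    · have e₁ := h₂ (f' c)
      have e₂ := h₂' c
      simp only [natDist, List.length_cons, Function.comp_apply] at *
      omega
    · rw [List.length_cons]
      by_cases h : a ∈ Set.range f
      · obtain ⟨c, rfl⟩ := h
        -- This bar survives the steps in `l` and dies in the next one. When it dies its endpoints
        -- differ by at most one, and before that their difference changed by at most `l.length`.
        have e₁ := h₂ c
        have e₂ := h₃' c fun ⟨c', hc'⟩ => ha ⟨c', by rw [← hc']; rfl⟩
        simp only [natDist] at *
        omega
      · have := h₃ a h
        omega

/-! ### Equivalence to a summand -/

theorem Sim.refl (V : ZModule F n) : Sim V V :=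
  Sim.iso ⟨fun _ => LinearEquiv.refl _ _, fun _ => Arrow.commutes_of_rel rfl fun _ _ h => h⟩

/-- The bars of a module equivalent to a summand of `W` are bars of `W`. -/
theorem SubSim.exists_injective {V W : ZModule F n} (h : V.SubSim W) {κ : Type} [Fintype κ]
    {bar : κ → ℕ × ℕ} (C : Coords V (fun c => InBar (bar c)))
    (hb : ∀ c, 1 ≤ (bar c).1 ∧ (bar c).1 ≤ (bar c).2 ∧ (bar c).2 ≤ n) :
    ∃ g : κ → W.dgm.ToType, Function.Injective g ∧ ∀ c, (g c).1 = bar c := by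
  obtain ⟨W', hs, U, hU, hiso⟩ := h
  obtain ⟨C'⟩ := C.nonempty_of_sim hs
  obtain ⟨ι, _, bar', hb', ⟨D⟩⟩ := U.exists_coords
  obtain ⟨E⟩ := (C'.prod D hU).nonempty_of_iso hiso
  let E' : Coords W (fun a => InBar (Sum.elim bar bar' a)) :=
    E.reindex (Equiv.refl _) (by rintro (a | a) j <;> rfl)
  have hdec := E'.isDecomposition (Sum.rec hb hb')
  obtain ⟨e, he⟩ := exists_equiv_toType (Sum.elim bar bar') hdec.dgm_eq.symm
  refine ⟨fun c => e.symm (Sum.inl c), fun c c' h => Sum.inl_injective (e.symm.injective h),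
    fun c => ?_⟩
  rw [← he, Equiv.apply_symm_apply]
  rfl

theorem sanitize_subSim (W : ZModule F n) : W.sanitize.SubSim W := by
  classical
  refine ⟨W.sanitize, Sim.refl _, intervalSum F W.type (W.dgm.filter fun x => ¬x.1 ≠ x.2),
    (intervalSum_type ..).trans (intervalSum_type ..).symm, ?_⟩
  obtain ⟨C⟩ := W.isDecomposition_dgm.nonempty_coords
  have D := (Coords.ofIntervalSum (F := F) W.type (W.dgm.filter fun x => x.1 ≠ x.2)).prod
    (Coords.ofIntervalSum (F := F) W.type (W.dgm.filter fun x => ¬x.1 ≠ x.2))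
    ((intervalSum_type ..).trans (intervalSum_type ..).symm)
  obtain ⟨e, he⟩ := exists_equiv_toType (D := W.dgm)
    (Sum.elim (fun a : (W.dgm.filter fun x => x.1 ≠ x.2).ToType => a.1)
      (fun a : (W.dgm.filter fun x => ¬x.1 ≠ x.2).ToType => a.1)) (by
    rw [← Finset.univ_disjSum_univ, Finset.val_disjSum, Multiset.disjSum, Multiset.map_add,
      Multiset.map_map, Multiset.map_map]
    refine Eq.trans ?_ (Multiset.filter_add_not (fun x => x.1 ≠ x.2) W.dgm)
    exact congrArg₂ _ (Multiset.map_univ_coe _) (Multiset.map_univ_coe _))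
  refine C.iso (D.reindex e fun a j => ?_)
    ((intervalSum_type ..).symm.trans (prod_type ..).symm)
  rw [← he]
  rcases e a with b | b <;> rfl

/-- A zero module is equivalent to a zero module of any given type. -/
theorem exists_sim_of_subsingleton (V : ZModule F n) (hV : ∀ j, Subsingleton (V.space j))
    (τ : ZType n) :
    ∃ W : ZModule F n, Sim V W ∧ (∀ j, Subsingleton (W.space j)) ∧ W.type = τ := by
  classical
  generalize hN : (Finset.univ.filter fun i => V.type i ≠ τ i).card = N
  induction N generalizing V with
  | zero =>
    refine ⟨V, Sim.refl V, hV, funext fun i => ?_⟩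
    by_contra h
    exact Finset.filter_eq_empty_iff.1 (Finset.card_eq_zero.1 hN) (Finset.mem_univ i) h
  | succ N ih =>
    obtain ⟨k, hk⟩ := Finset.card_pos.1 (hN.symm ▸ Nat.succ_pos N :
      0 < (Finset.univ.filter fun i => V.type i ≠ τ i).card)
    have hk' : V.type k ≠ τ k := (Finset.mem_filter.1 hk).2
    have h₁ := hV (lo k)
    have h₂ := hV (hi k)
    -- Between zero spaces every arrow is an isomorphism, so the directions can be corrected one at
    -- a time.
    have hiso : (V.arrow k).IsIso := by
      cases V.arrow k <;> exact ⟨fun _ _ _ => Subsingleton.elim _ _, fun _ =>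
        ⟨0, Subsingleton.elim _ _⟩⟩
    have ht : ∀ i, (V.reverse k hiso).type i = if i = k then τ k else V.type i := by
      intro i
      by_cases hi : i = k
      · subst hi
        rw [if_pos rfl]
        have e₁ : (V.reverse i hiso).type i = ((V.arrow i).reverse hiso).dir :=
          congrArg Arrow.dir (Function.update_self ..)
        have e₂ := (V.arrow i).reverse_dir hiso
        rw [← e₁] at e₂
        change _ ≠ V.type i at e₂
        revert e₂ hk'
        cases (V.reverse i hiso).type i <;> cases V.type i <;> cases τ i <;> simp
      · rw [if_neg hi]
        exact congrArg Arrow.dir (Function.update_of_ne hi ..)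
    obtain ⟨W, hs, hW, hτ⟩ := ih (V.reverse k hiso) hV (by
      have : (Finset.univ.filter fun i => (V.reverse k hiso).type i ≠ τ i) =
          (Finset.univ.filter fun i => V.type i ≠ τ i).erase k := by
        ext i
        simp only [ht, Finset.mem_filter, Finset.mem_univ, true_and, Finset.mem_erase]
        by_cases hi : i = k
        · simp [hi]
        · simp [hi]
      rw [this, Finset.card_erase_of_mem hk, hN]
      rfl)
    exact ⟨W, Sim.reverse k hiso hs, hW, hτ⟩

/-- A direct summand must have the type of `W`, so the zero module is first brought to this type by
reversals; then `W ≅ 0 ⊕ W`. -/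
theorem subSim_of_isEmpty {V : ZModule F n} {κ : Type} [IsEmpty κ] {P : κ → Fin n → Prop}
    (C : Coords V P) (W : ZModule F n) : V.SubSim W := by
  obtain ⟨W', hs, hW', ht⟩ := V.exists_sim_of_subsingleton
    (fun j => ⟨fun x y => C.inj j (Subsingleton.elim _ _)⟩) W.type
  refine ⟨W', hs, W, ht, ?_⟩
  obtain ⟨ι, _, bar, -, ⟨D⟩⟩ := W.exists_coords
  refine D.iso (((Coords.ofSubsingleton W' hW' (ι := Empty) isEmptyElim).prod D ht).reindex
    (Equiv.emptySum Empty ι).symm fun a j => Iff.rfl) (ht.symm.trans (prod_type ..).symm)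

/-! ### Annihilation by reflections -/

theorem reflectSeq_cons_type (V : ZModule F n) (R : Reflection n) (l : List (Reflection n)) :
    (V.reflectSeq (R :: l)).type = ((V.reflectSeq l).reflect R).type :=
  sanitize_type _

/-- Positions are cleared from left to right, at three reflections each. Introversions at `k` and
then `k + 1` make the arrows around `k` point forward, as in `0 → V_k → V_{k+1}`. The limit of this
diagram is its leftmost space, which is zero, so an extroversion at `k` clears the position. -/
theorem exists_reflectSeq_vanish (V : ZModule F n) (k : ℕ) (hk : k ≤ n - 1) :
    ∃ l : List (Reflection n), l.length = 3 * k ∧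
      ∃ (κ : Type) (_ : Fintype κ) (bar : κ → ℕ × ℕ),
        (∀ c, 1 ≤ (bar c).1 ∧ (bar c).1 < (bar c).2 ∧ (bar c).2 ≤ n) ∧
        (∀ c (j : Fin n), j.1 < k → ¬InBar (bar c) j) ∧
        Nonempty (Coords (V.reflectSeq l) (fun c => InBar (bar c))) := by
  induction k with
  | zero =>
    obtain ⟨ι, _, bar, hb, ⟨C⟩⟩ := V.exists_coords
    obtain ⟨κ, _, f, bar', -, h₁, -, -, C'⟩ := C.reflectSeq hb []
    exact ⟨[], rfl, κ, inferInstance, bar', h₁, fun c j hj => absurd hj (Nat.not_lt_zero _), C'⟩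
  | succ k ih =>
    obtain ⟨l, hl, κ, _, bar, hb, hv, ⟨C⟩⟩ := ih (by omega)
    let k₀ : Fin n := ⟨k, by omega⟩
    let k₁ : Fin n := ⟨k + 1, by omega⟩
    let R₁ : Reflection n := Reflection.int k₀ Dir.fwd
    let R₂ : Reflection n := Reflection.int k₁ Dir.fwd
    -- At `k = 0` the direction `Dir.fwd` adds the arrow `0 → V₁`, which forces the limit to vanish
    -- there too.
    let R₃ : Reflection n := Reflection.ext k₀ Dir.fwd
    obtain ⟨κ₁, _, f₁, bar₁, -, hb₁, -, -, hp₁, ⟨C₁⟩⟩ := C.reflect_sanitize hb R₁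
    have hv₁ : ∀ c (j : Fin n), j.1 < k → ¬InBar (bar₁ c) j := by
      intro c j hj
      have hne : j ≠ k₀ := fun h => by rw [h] at hj; exact absurd hj (lt_irrefl _)
      rw [hp₁, show R₁.pos = k₀ from rfl, Function.update_of_ne hne]
      exact hv _ j hj
    have ht₁ : ∀ i : Fin (n - 1), i.1 + 1 = k → (V.reflectSeq (R₁ :: l)).type i = Dir.fwd := by
      intro i hi
      rw [reflectSeq_cons_type]
      exact (introvert_type ..).trans (if_pos (Fin.ext hi))
    obtain ⟨κ₂, _, f₂, bar₂, -, hb₂, -, -, hp₂, ⟨C₂⟩⟩ := C₁.reflect_sanitize hb₁ R₂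
    have hv₂ : ∀ c (j : Fin n), j.1 < k → ¬InBar (bar₂ c) j := by
      intro c j hj
      have hne : j ≠ k₁ := fun h => by
        rw [h] at hj
        exact absurd hj (Nat.not_lt.2 (Nat.le_succ k))
      rw [hp₂, show R₂.pos = k₁ from rfl, Function.update_of_ne hne]
      exact hv₁ _ j hj
    have ht₂ : ∀ i : Fin (n - 1), i.1 + 1 = k ∨ i.1 = k →
        (V.reflectSeq (R₂ :: R₁ :: l)).type i = Dir.fwd := by
      intro i hi
      rw [reflectSeq_cons_type]
      refine (introvert_type ..).trans ?_
      rcases hi with h | h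
      · rw [if_neg, if_neg]
        · exact ht₁ i h
        · intro h'
          have : i.1 = k + 1 := congrArg Fin.val h'
          omega
        · intro h'
          have : i.1 + 1 = k + 1 := congrArg Fin.val h'
          omega
      · exact if_pos (Fin.ext (by change i.1 + 1 = k + 1; rw [h]))
    obtain ⟨κ₃, _, f₃, bar₃, -, hb₃, -, -, hp₃, C₃⟩ := C₂.reflect_sanitize hb₂ R₃
    refine ⟨R₃ :: R₂ :: R₁ :: l, by simp only [List.length_cons]; omega, κ₃, inferInstance, bar₃,
      hb₃, fun c j hj => ?_, C₃⟩
    rw [hp₃, show R₃.pos = k₀ from rfl]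
    by_cases hjk : j = k₀
    · rw [hjk, Function.update_self]
      -- A bar alive at `k` meets some neighbour. Following the forward arrows back to their
      -- sources, it would have to meet the cleared position to the left of `k` or, for `k = 0`, the
      -- added zero space.
      rintro ⟨⟨⟨m, hm⟩, hpm⟩, ha, h0, -⟩
      replace hpm : InBar _ m := hpm
      have hk0 : ¬InBar (bar₂ (f₃ c)) k₀ := by
        intro hin
        by_cases hz : k = 0
        · exact h0 hz rfl hin
        · let i : Fin (n - 1) := ⟨k - 1, by omega⟩
          have hhi : hi i = k₀ := Fin.ext (by change k - 1 + 1 = k; omega)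
          have ht := ht₂ i (Or.inl (by change k - 1 + 1 = k; omega))
          have hs := ha i (mem_nbr_of_hi_eq hhi) (by rw [hhi]; simp) (by
            change InBar _ (tgt ((V.reflectSeq (R₂ :: R₁ :: l)).type i) i)
            rw [ht]
            change InBar _ (hi i)
            rwa [hhi])
          change InBar _ (src ((V.reflectSeq (R₂ :: R₁ :: l)).type i) i) at hs
          rw [ht] at hs
          exact hv₂ _ (lo i) (by change k - 1 < k; omega) hs
      rcases lt_trichotomy m.1 k with h | h | h
      · exact hv₂ _ m h hpm
      · exact hk0 (by rwa [show m = k₀ from Fin.ext h] at hpm)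
      · let i : Fin (n - 1) := ⟨k, by omega⟩
        have hmi : m = hi i := Fin.ext (by
          change m.1 = k + 1
          have : m.1 ≤ k + 1 := hm.2
          omega)
        have ht := ht₂ i (Or.inr rfl)
        have hs := ha i ⟨Nat.le_succ _, Nat.le_succ _⟩ (mem_nbr_of_lo_eq rfl) (by
          change InBar _ (tgt ((V.reflectSeq (R₂ :: R₁ :: l)).type i) i)
          rw [ht]
          change InBar _ (hi i)
          rwa [← hmi])
        change InBar _ (src ((V.reflectSeq (R₂ :: R₁ :: l)).type i) i) at hs
        rw [ht] at hs
        exact hk0 hs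
    · rw [Function.update_of_ne hjk]
      have : j.1 ≠ k := fun h => hjk (Fin.ext h)
      exact hv₂ _ j (by omega)

/-- Every zigzag module is annihilated by a short sequence of reflections. -/
theorem exists_reflectSeq_subSim (V W : ZModule F n) :
    ∃ l : List (Reflection n), l.length = 3 * (n - 1) ∧ (V.reflectSeq l).SubSim W := by
  obtain ⟨l, hl, κ, _, bar, hb, hv, ⟨C⟩⟩ := V.exists_reflectSeq_vanish (n - 1) le_rfl
  -- A bar avoiding the first `n - 1` positions could only be the simple one at `n`, and simple bars
  -- have been removed.
  have : IsEmpty κ := ⟨fun c => by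
    have h := hb c
    refine hv c ⟨(bar c).1 - 1, by omega⟩ (by simp only; omega) ?_
    simp only [InBar]
    omega⟩
  exact ⟨l, hl, subSim_of_isEmpty C W⟩

end ZModule

/-! ### Matchings -/

open Classical in
/-- The partial equivalence with a given graph. -/
def pequivOfRel {α β : Type*} (H : α → β → Prop) (h₁ : ∀ s t t', H s t → H s t' → t = t')
    (h₂ : ∀ s s' t, H s t → H s' t → s = s') : α ≃. β where
  toFun s := if h : ∃ t, H s t then some h.choose else none
  invFun t := if h : ∃ s, H s t then some h.choose else none
  inv s t := by
    have e₁ : (s ∈ if h : ∃ s, H s t then some h.choose else none) ↔ H s t := by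
      split
      · next h =>
        rw [Option.mem_some_iff]
        exact ⟨fun h' => h' ▸ h.choose_spec, fun h' => h₂ _ _ _ h.choose_spec h'⟩
      · next h => exact ⟨fun h' => (Option.not_mem_none _ h').elim, fun h' => (h ⟨s, h'⟩).elim⟩
    have e₂ : (t ∈ if h : ∃ t, H s t then some h.choose else none) ↔ H s t := by
      split
      · next h =>
        rw [Option.mem_some_iff]
        exact ⟨fun h' => h' ▸ h.choose_spec, fun h' => h₁ _ _ _ h.choose_spec h'⟩
      · next h => exact ⟨fun h' => (Option.not_mem_none _ h').elim, fun h' => (h ⟨t, h'⟩).elim⟩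
    exact e₁.trans e₂.symm

theorem mem_pequivOfRel {α β : Type*} {H : α → β → Prop}
    {h₁ : ∀ s t t', H s t → H s t' → t = t'} {h₂ : ∀ s s' t, H s t → H s' t → s = s'} {s : α}
    {t : β} : t ∈ pequivOfRel H h₁ h₂ s ↔ H s t := by
  classical
  change (t ∈ if h : ∃ t, H s t then some h.choose else none) ↔ H s t
  split
  · next h =>
    rw [Option.mem_some_iff]
    exact ⟨fun h' => h' ▸ h.choose_spec, fun h' => h₁ _ _ _ h.choose_spec h'⟩
  · next h => exact ⟨fun h' => (Option.not_mem_none _ h').elim, fun h' => (h ⟨t, h'⟩).elim⟩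

/-- The theorem of Mendelsohn and Dulmage: two matchings can be combined to a matching that
covers all points of the left side covered by the first and all points of the right side covered
by the second. -/
theorem exists_pequiv_of_pequiv {α β : Type*} (M N : α ≃. β) :
    ∃ K : α ≃. β, (∀ s t, t ∈ K s → t ∈ M s ∨ t ∈ N s) ∧
      (∀ s, K s = none → M s = none) ∧ (∀ t, K.symm t = none → N.symm t = none) := by
  -- The least fixed point `A` consists of the left points that switch from `M` to `N`: those whose
  -- `N`-partner is not used by `M`, or is used by a point that itself switches. A left point that
  -- does not switch keeps its `M`-partner. If the `N`-partner of a right point does not switch,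
  -- then this right point has an `M`-partner that does not switch either, so it stays covered.
  let Φ : Set α →o Set α :=
    { toFun := fun A => {s | ∃ t, t ∈ N s ∧ ∀ s', t ∈ M s' → s' ∈ A}
      monotone' := fun A B hAB s ⟨t, h, h'⟩ => ⟨t, h, fun s' hs' => hAB (h' s' hs')⟩ }
  let A : Set α := Φ.lfp
  have hA : ∀ s, s ∈ A ↔ ∃ t, t ∈ N s ∧ ∀ s', t ∈ M s' → s' ∈ A := fun s => by
    conv_lhs => rw [show A = Φ A from Φ.map_lfp.symm]
    rfl
  let H : α → β → Prop := fun s t => (s ∈ A ∧ t ∈ N s) ∨ (s ∉ A ∧ t ∈ M s)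
  have hcross : ∀ s s' t, s ∈ A → t ∈ N s → t ∈ M s' → s' ∈ A := by
    intro s s' t hs ht ht'
    obtain ⟨t₀, h0, h⟩ := (hA s).1 hs
    rw [Option.mem_unique ht h0] at ht'
    exact h s' ht'
  have h₁ : ∀ s t t', H s t → H s t' → t = t' := by
    rintro s t t' (⟨h, ht⟩ | ⟨h, ht⟩) (⟨h', ht'⟩ | ⟨h', ht'⟩)
    · exact Option.mem_unique ht ht'
    · exact absurd h h'
    · exact absurd h' h
    · exact Option.mem_unique ht ht'
  have h₂ : ∀ s s' t, H s t → H s' t → s = s' := by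
    rintro s s' t (⟨h, ht⟩ | ⟨h, ht⟩) (⟨h', ht'⟩ | ⟨h', ht'⟩)
    · exact N.inj ht ht'
    · exact absurd (hcross s s' t h ht ht') h'
    · exact absurd (hcross s' s t h' ht' ht) h
    · exact M.inj ht ht'
  refine ⟨pequivOfRel H h₁ h₂, fun s t h => ?_, fun s hs => ?_, fun t ht => ?_⟩
  · rcases mem_pequivOfRel.1 h with h | h
    · exact Or.inr h.2
    · exact Or.inl h.2
  · have hH : ∀ t, ¬H s t := fun t h => by
      have := mem_pequivOfRel (h₁ := h₁) (h₂ := h₂).2 h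
      rw [hs] at this
      exact Option.not_mem_none _ this
    refine Option.eq_none_iff_forall_not_mem.2 fun t ht => ?_
    by_cases h : s ∈ A
    · obtain ⟨t₀, h0, -⟩ := (hA s).1 h
      exact hH t₀ (Or.inl ⟨h, h0⟩)
    · exact hH t (Or.inr ⟨h, ht⟩)
  · have hH : ∀ s, ¬H s t := fun s h => by
      have := (PEquiv.mem_iff_mem _).2 (mem_pequivOfRel (h₁ := h₁) (h₂ := h₂).2 h)
      rw [ht] at this
      exact Option.not_mem_none _ this
    refine Option.eq_none_iff_forall_not_mem.2 fun s hs => ?_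
    rw [PEquiv.mem_iff_mem] at hs
    by_cases h : s ∈ A
    · exact hH s (Or.inl ⟨h, hs⟩)
    · refine h ((hA s).2 ⟨t, hs, fun s' hs' => ?_⟩)
      by_contra h'
      exact hH s' (Or.inr ⟨h', hs'⟩)

theorem ofReal_abs_add_eq_natDist (x y : ℕ × ℕ) :
    ENNReal.ofReal (|(x.1 : ℝ) - y.1| + |(x.2 : ℝ) - y.2|) = (natDist x y : ℝ≥0∞) := by
  have h : ∀ a b : ℕ, |(a : ℝ) - b| = ((a - b + (b - a) : ℕ) : ℝ) := by
    intro a b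
    rcases le_total a b with h | h
    · rw [abs_of_nonpos (sub_nonpos.2 (Nat.cast_le.2 h)), Nat.sub_eq_zero_of_le h, zero_add,
        Nat.cast_sub h, neg_sub]
    · rw [abs_of_nonneg (sub_nonneg.2 (Nat.cast_le.2 h)), Nat.sub_eq_zero_of_le h, add_zero,
        Nat.cast_sub h]
  rw [h, h, ← Nat.cast_add, ENNReal.ofReal_natCast, natDist]

theorem ofReal_abs_eq_sub {x : ℕ × ℕ} (hx : x.1 ≤ x.2) :
    ENNReal.ofReal |(x.2 : ℝ) - x.1| = ((x.2 - x.1 : ℕ) : ℝ≥0∞) := by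
  rw [abs_of_nonneg (sub_nonneg.2 (Nat.cast_le.2 hx)), ← Nat.cast_sub hx, ENNReal.ofReal_natCast]

/-- The points of the diagram in the plane. -/
def planeEquiv (D : Multiset (ℕ × ℕ)) : D.ToType ≃ (toPlane D).ToType :=
  D.mapEquiv fun x => ((x.1 : ℝ), (x.2 : ℝ))

theorem planeEquiv_apply (D : Multiset (ℕ × ℕ)) (s : D.ToType) :
    (planeEquiv D s).1 = ((s.1.1 : ℝ), (s.1.2 : ℝ)) :=
  Multiset.mapEquiv_apply _ _ _

/-- The transport of a partial equivalence along equivalences. -/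
def pequivCongr {α β α' β' : Type*} (e₁ : α ≃ α') (e₂ : β ≃ β') (M : α ≃. β) : α' ≃. β' where
  toFun s := (M (e₁.symm s)).map e₂
  invFun t := (M.symm (e₂.symm t)).map e₁
  inv s t := by
    simp only [Option.map_eq_some_iff, ← Equiv.eq_symm_apply]
    simp only [exists_eq_right, ← Option.mem_def]
    exact PEquiv.mem_iff_mem M

theorem pequivCongr_apply {α β α' β' : Type*} (e₁ : α ≃ α') (e₂ : β ≃ β') (M : α ≃. β) (s : α) :
    pequivCongr e₁ e₂ M (e₁ s) = (M s).map e₂ := by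
  change (M (e₁.symm (e₁ s))).map e₂ = _
  rw [Equiv.symm_apply_apply]

theorem pequivCongr_symm_apply {α β α' β' : Type*} (e₁ : α ≃ α') (e₂ : β ≃ β') (M : α ≃. β)
    (t : β) : (pequivCongr e₁ e₂ M).symm (e₂ t) = (M.symm t).map e₁ := by
  change (M.symm (e₂.symm (e₂ t))).map e₁ = _
  rw [Equiv.symm_apply_apply]

theorem bottleneckDist_le {D E : Multiset (ℕ × ℕ)} (hD : ∀ x ∈ D, x.1 ≤ x.2)
    (hE : ∀ x ∈ E, x.1 ≤ x.2) (M : D.ToType ≃. E.ToType) (c : ℕ)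
    (h : ∀ s t, t ∈ M s → natDist s.1 t.1 ≤ c) (hs : ∀ s, M s = none → s.1.2 - s.1.1 ≤ c)
    (ht : ∀ t, M.symm t = none → t.1.2 - t.1.1 ≤ c) :
    bottleneckDist (toPlane D) (toPlane E) ≤ c := by
  refine (iInf_le _ (pequivCongr (planeEquiv D) (planeEquiv E) M)).trans (max_le ?_ (max_le ?_ ?_))
  · refine iSup_le fun s => iSup_le fun t => iSup_le fun hst => ?_
    obtain ⟨s, rfl⟩ := (planeEquiv D).surjective s
    obtain ⟨t, rfl⟩ := (planeEquiv E).surjective t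
    have hst' : t ∈ M s := by
      simpa [pequivCongr_apply] using hst
    simp only [planeEquiv_apply]
    rw [ofReal_abs_add_eq_natDist]
    exact Nat.cast_le.2 (h s t hst')
  · refine iSup_le fun s => iSup_le fun hsn => ?_
    obtain ⟨s, rfl⟩ := (planeEquiv D).surjective s
    have hsn' : M s = none := by
      simpa only [pequivCongr_apply, Option.map_eq_none_iff] using hsn
    simp only [planeEquiv_apply]
    rw [ofReal_abs_eq_sub (hD _ Multiset.coe_mem)]
    exact Nat.cast_le.2 (hs s hsn')
  · refine iSup_le fun t => iSup_le fun htn => ?_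
    obtain ⟨t, rfl⟩ := (planeEquiv E).surjective t
    have htn' : M.symm t = none := by
      simpa only [pequivCongr_symm_apply, Option.map_eq_none_iff] using htn
    simp only [planeEquiv_apply]
    rw [ofReal_abs_eq_sub (hE _ Multiset.coe_mem)]
    exact Nat.cast_le.2 (ht t htn')

/-- A bottleneck distance less than one is realized by a matching that only pairs equal points
and misses only points of the diagonal. -/
theorem exists_matching_of_bottleneckDist_lt_one {D E : Multiset (ℕ × ℕ)}
    (hD : ∀ x ∈ D, x.1 ≤ x.2) (hE : ∀ x ∈ E, x.1 ≤ x.2)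
    (h : bottleneckDist (toPlane D) (toPlane E) < 1) :
    ∃ M : D.ToType ≃. E.ToType, (∀ s t, t ∈ M s → s.1 = t.1) ∧
      (∀ s, M s = none → s.1.1 = s.1.2) ∧ (∀ t, M.symm t = none → t.1.1 = t.1.2) := by
  obtain ⟨N, hN⟩ := iInf_lt_iff.1 h
  obtain ⟨h₁, h₂₃⟩ := max_lt_iff.1 hN
  obtain ⟨h₂, h₃⟩ := max_lt_iff.1 h₂₃
  obtain ⟨M, rfl⟩ : ∃ M, pequivCongr (planeEquiv D) (planeEquiv E) M = N := by
    refine ⟨pequivCongr (planeEquiv D).symm (planeEquiv E).symm N, PEquiv.ext fun s => ?_⟩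
    obtain ⟨s, rfl⟩ := (planeEquiv D).surjective s
    rw [pequivCongr_apply]
    have := pequivCongr_apply (planeEquiv D).symm (planeEquiv E).symm N (planeEquiv D s)
    rw [Equiv.symm_apply_apply] at this
    rw [this, Option.map_map, Equiv.self_comp_symm, Option.map_id, id]
  refine ⟨M, fun s t hst => ?_, fun s hs => ?_, fun t ht => ?_⟩
  · have hst' : planeEquiv E t ∈ pequivCongr (planeEquiv D) (planeEquiv E) M (planeEquiv D s) := by
      simpa [pequivCongr_apply] using hst
    have := lt_of_le_of_lt (le_iSup_of_le (planeEquiv D s) (le_iSup_of_le (planeEquiv E t)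
      (le_iSup_of_le hst' le_rfl))) h₁
    simp only [planeEquiv_apply] at this
    rw [ofReal_abs_add_eq_natDist, Nat.cast_lt_one] at this
    simp only [natDist] at this
    exact Prod.ext (by omega) (by omega)
  · have hs' : pequivCongr (planeEquiv D) (planeEquiv E) M (planeEquiv D s) = none := by
      simpa only [pequivCongr_apply, Option.map_eq_none_iff] using hs
    have := lt_of_le_of_lt (le_iSup_of_le (planeEquiv D s) (le_iSup_of_le hs' le_rfl)) h₂
    simp only [planeEquiv_apply] at this
    rw [ofReal_abs_eq_sub (hD _ Multiset.coe_mem), Nat.cast_lt_one] at this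
    have := hD s.1 Multiset.coe_mem
    omega
  · have ht' : (pequivCongr (planeEquiv D) (planeEquiv E) M).symm (planeEquiv E t) = none := by
      simpa only [pequivCongr_symm_apply, Option.map_eq_none_iff] using ht
    have := lt_of_le_of_lt (le_iSup_of_le (planeEquiv E t) (le_iSup_of_le ht' le_rfl)) h₃
    simp only [planeEquiv_apply] at this
    rw [ofReal_abs_eq_sub (hE _ Multiset.coe_mem), Nat.cast_lt_one] at this
    have := hE t.1 Multiset.coe_mem
    omega

/-- Off-diagonal points cannot be unmatched, and they are matched injectively to equal points. -/
theorem filter_le_of_matching {D E : Multiset (ℕ × ℕ)} (M : D.ToType ≃. E.ToType)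
    (h : ∀ s t, t ∈ M s → s.1 = t.1) (hs : ∀ s, M s = none → s.1.1 = s.1.2) :
    (D.filter fun x => x.1 ≠ x.2) ≤ E.filter fun x => x.1 ≠ x.2 := by
  have hex : ∀ s : {s : D.ToType // s.1.1 ≠ s.1.2}, ∃ t, t ∈ M s.1 := fun s => by
    by_contra hcon
    exact s.2 (hs s.1 (Option.eq_none_iff_forall_not_mem.2 fun t ht => hcon ⟨t, ht⟩))
  choose g hg using hex
  have hinj : Function.Injective g := fun s s' hss =>
    Subtype.ext (M.inj (hg s) (hss ▸ hg s'))
  have key : (D.filter fun x => x.1 ≠ x.2) ≤ E := by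
    have e₁ := ZModule.map_subtype_univ (fun s : D.ToType => s.1) fun x => x.1 ≠ x.2
    have e₂ : Finset.univ.val.map (fun s : D.ToType => s.1) = D := Multiset.map_univ_coe D
    have e₃ : Finset.univ.val.map (fun t : E.ToType => t.1) = E := Multiset.map_univ_coe E
    rw [e₂] at e₁
    rw [← e₁, ← e₃, Multiset.map_congr rfl fun s _ => h s.1 (g s) (hg s)]
    refine (Multiset.map_map (fun t : E.ToType => t.1) g _).symm.trans_le
      (Multiset.map_le_map ?_)
    exact (Multiset.le_iff_subset (Multiset.Nodup.map hinj Finset.univ.nodup)).2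
      fun t _ => Finset.mem_univ t
  have := Multiset.filter_le_filter (fun x : ℕ × ℕ => x.1 ≠ x.2) key
  rwa [Multiset.filter_filter, Multiset.filter_congr fun x _ => and_self_iff] at this

/-! ### The two inequalities -/

namespace ZModule

variable {F : Type u} [Field F] {n : ℕ}

/-- The diagrams agree off the diagonal, and `sanitize` depends only on this part of the diagram and
on the type. The assumption of a common type enters here. -/
theorem sanitize_eq_of_bottleneckDist_lt_one {V W : ZModule F n} (hVW : V.type = W.type)
    (h : bottleneckDist (toPlane V.dgm) (toPlane W.dgm) < 1) : V.sanitize = W.sanitize := by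
  obtain ⟨M, h₁, h₂, h₃⟩ := exists_matching_of_bottleneckDist_lt_one
    (fun x hx => (V.isDecomposition_dgm.1 x hx).2.1)
    (fun x hx => (W.isDecomposition_dgm.1 x hx).2.1) h
  have heq := le_antisymm (filter_le_of_matching M h₁ h₂) (filter_le_of_matching M.symm
    (fun t s hts => (h₁ s t ((PEquiv.mem_iff_mem _).1 hts)).symm) h₃)
  rw [sanitize, sanitize, hVW, heq]

/-- The matching of the diagrams of `V` and `W` induced by a sequence of reflections that turns
`V` into a summand of `W`. -/
theorem SubSim.exists_matching {V W : ZModule F n} {l : List (Reflection n)}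
    (h : (V.reflectSeq l).SubSim W) :
    ∃ M : V.dgm.ToType ≃. W.dgm.ToType, (∀ s t, t ∈ M s → natDist s.1 t.1 ≤ l.length) ∧
      ∀ s, M s = none → s.1.2 - s.1.1 ≤ l.length := by
  obtain ⟨C⟩ := V.isDecomposition_dgm.nonempty_coords
  obtain ⟨κ, _, f, bar, hf, hb, hd, hdie, ⟨C'⟩⟩ := C.reflectSeq
    (fun a => V.isDecomposition_dgm.1 _ Multiset.coe_mem) l
  obtain ⟨g, hg, hgb⟩ := h.exists_injective C' fun c => ⟨(hb c).1, (hb c).2.1.le, (hb c).2.2⟩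
  have h₁ : ∀ s t t', (∃ c, f c = s ∧ g c = t) → (∃ c, f c = s ∧ g c = t') → t = t' := by
    rintro _ _ _ ⟨c, rfl, rfl⟩ ⟨c', hc', rfl⟩
    rw [hf hc']
  have h₂ : ∀ s s' t, (∃ c, f c = s ∧ g c = t) → (∃ c, f c = s' ∧ g c = t) → s = s' := by
    rintro _ _ _ ⟨c, rfl, rfl⟩ ⟨c', rfl, hc'⟩
    rw [hg hc']
  -- Each bar `c` of the reflected module links the bar `f c` of `V` it came from with its copy `g
  -- c` in the diagram of `W`.
  refine ⟨pequivOfRel (fun s t => ∃ c, f c = s ∧ g c = t) h₁ h₂, fun s t hst => ?_,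
    fun s hs => hdie s ?_⟩
  · obtain ⟨c, rfl, rfl⟩ := mem_pequivOfRel.1 hst
    rw [hgb]
    exact hd c
  · rintro ⟨c, rfl⟩
    have := mem_pequivOfRel (h₁ := h₁) (h₂ := h₂).2 ⟨c, rfl, rfl⟩
    rw [hs] at this
    exact Option.not_mem_none _ this

/-- Each of the two sequences gives a matching that controls the unmatched points of one side only;
the matching `K` combined from both controls the two sides at once. -/
theorem bottleneckDist_le_reflectionDist (V W : ZModule F n) :
    bottleneckDist (toPlane V.dgm) (toPlane W.dgm) ≤ V.reflectionDist W := by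
  refine le_iInf₂ fun R R' => le_iInf₂ fun h h' => ?_
  obtain ⟨M, hM, hM'⟩ := h.exists_matching
  obtain ⟨N, hN, hN'⟩ := h'.exists_matching
  obtain ⟨K, hK, hK₁, hK₂⟩ := exists_pequiv_of_pequiv M N.symm
  rw [← (Nat.mono_cast (α := ℝ≥0∞)).map_max]
  refine bottleneckDist_le (fun x hx => (V.isDecomposition_dgm.1 x hx).2.1)
    (fun x hx => (W.isDecomposition_dgm.1 x hx).2.1) K _ (fun s t hst => ?_)
    (fun s hs => (hM' s (hK₁ s hs)).trans (le_max_left _ _))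
    (fun t ht => (hN' t (hK₂ t ht)).trans (le_max_right _ _))
  rcases hK s t hst with h | h
  · exact (hM s t h).trans (le_max_left _ _)
  · have := (hN t s ((PEquiv.mem_iff_mem _).1 h)).trans (le_max_right R.length _)
    simp only [natDist] at this ⊢
    omega

theorem reflectionDist_le {V W : ZModule F n} {R R' : List (Reflection n)} {c : ℕ}
    (h : (V.reflectSeq R).SubSim W) (h' : (W.reflectSeq R').SubSim V) (hR : R.length ≤ c)
    (hR' : R'.length ≤ c) : V.reflectionDist W ≤ c :=
  (iInf₂_le_of_le R R' (iInf₂_le h h')).trans (max_le (Nat.cast_le.2 hR) (Nat.cast_le.2 hR'))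

theorem reflectionDist_le_three_mul (V W : ZModule F n) :
    V.reflectionDist W ≤ ((3 * (n - 1) : ℕ) : ℝ≥0∞) := by
  obtain ⟨l, hl, h⟩ := V.exists_reflectSeq_subSim W
  obtain ⟨l', hl', h'⟩ := W.exists_reflectSeq_subSim V
  exact reflectionDist_le h h' hl.le hl'.le

end ZModule

end Zigzag

end

theorem mainTheorem3 (F : Type u) [Field F] (n : ℕ) (τ : Zigzag.ZType n)
    (V W : Zigzag.ZModule F n) (hV : V.type = τ) (hW : W.type = τ) :
    Zigzag.bottleneckDist (Zigzag.toPlane V.dgm) (Zigzag.toPlane W.dgm) ≤ V.reflectionDist W ∧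
    V.reflectionDist W ≤
      (n : ENNReal) ^ 2 * ((n : ENNReal) + 1) *
        Zigzag.bottleneckDist (Zigzag.toPlane V.dgm) (Zigzag.toPlane W.dgm) ∧
    V.reflectionDist W < ⊤ := by
  refine ⟨V.bottleneckDist_le_reflectionDist W, ?_,
    (V.reflectionDist_le_three_mul W).trans_lt (ENNReal.natCast_lt_top _)⟩
  have hVW : V.type = W.type := hV.trans hW.symm
  -- All costs are integers, so the threshold `1` separates diagrams equal off the diagonal from
  -- those for which annihilating both modules is cheap enough.
  rcases lt_or_ge (Zigzag.bottleneckDist (Zigzag.toPlane V.dgm) (Zigzag.toPlane W.dgm)) 1 with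
    h | h
  · have hs := Zigzag.ZModule.sanitize_eq_of_bottleneckDist_lt_one hVW h
    have h₁ : (V.reflectSeq []).SubSim W := by
      change V.sanitize.SubSim W
      rw [hs]
      exact W.sanitize_subSim
    have h₂ : (W.reflectSeq []).SubSim V := by
      change W.sanitize.SubSim V
      rw [← hs]
      exact V.sanitize_subSim
    exact (Zigzag.ZModule.reflectionDist_le (c := 0) h₁ h₂ le_rfl le_rfl).trans (by simp)
  · have hn : 3 * (n - 1) ≤ n ^ 2 * (n + 1) := by
      rcases n with _ | _ | n
      · simp
      · simp
      · simp only [Nat.add_sub_cancel]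
        nlinarith
    calc V.reflectionDist W ≤ ((3 * (n - 1) : ℕ) : ENNReal) := V.reflectionDist_le_three_mul W
      _ ≤ ((n ^ 2 * (n + 1) : ℕ) : ENNReal) := Nat.cast_le.2 hn
      _ = (n : ENNReal) ^ 2 * ((n : ENNReal) + 1) * 1 := by push_cast; ring
      _ ≤ _ := mul_le_mul_right h _
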